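/- Let $\mathcal A$ be a finite alphabet, $\mathcal A^*$ the set of finite words over $\mathcal A$, and $\varepsilon$ the empty word. A PDF0L system is a triple $S=(\mathcal A,\varphi,W)$, where $\varphi\colon\mathcal A^*\to\mathcal A^*$ is a morphism with $\varphi(a)\neq\varepsilon$ for all $a\in\mathcal A$, and $W$ is a non-empty finite set of non-empty words over $\mathcal A$. Its language $\mathcal L(S)$ is the set of all factors of the words $\varphi^k(w)$ with $w\in W$, $k\ge 0$. An interpretation of a word $u$ in $S$ is a triple $(s,w,t)$ of words with $w\in\mathcal L(S)$ and $\varphi(w)=sut$. A pair of words $(u',u'')$ is compatible with an interpretation $(s,w,t)$ of $u'u''$ if there are words $w',w''$ with $w=w'w''$, $\varphi(w')=su'$ and $\varphi(w'')=u''t$. The pair is admissible if it is compatible with at least one interpretation of $u'u''$, and weakly synchronizing if it is compatible with all interpretations of $u'u''$. A word $u$ is weakly synchronized if $u=u'u''$ for some weakly synchronizing pair $(u',u'')$. A pair $(u',u'')$ with $u'\neq\varepsilon$ is strongly synchronizing if there is a letter $a\in\mathcal A$ such that for every interpretation $(s,w,t)$ of $u'u''$ there are words $w',w''$ with $w=w'w''$,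 $\varphi(w')=su'$, $\varphi(w'')=u''t$, and $w'$ ends with $a$. The system $S$ is weakly circular if there is an integer $D\ge 0$ such that every $u\in\mathcal L(S)$ with $|u|>D$ is weakly synchronized. It is strongly circular if there is an integer $D'\ge 0$ such that every admissible pair $(u',u'')$ with $|u'|>D'$ and $|u''|>D'$ is strongly synchronizing. A word $w$ is unbounded if the lengths $|\varphi^k(w)|$, $k\ge 0$, are unbounded. The system $S$ is unboundedly repetitive if there is an unbounded word $v\in\mathcal L(S)$ such that $v^k\in\mathcal L(S)$ for all $k\in\mathbb N$. Theorem. Let $S=(\mathcal A,\varphi,W)$ be a PDF0L system. 1. If $S$ is not weakly circular, then $S$ is unboundedly repetitive. 2. If $S$ is unboundedly repetitive, then $S$ is not strongly circular. -/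

import Mathlib

/-- A DF0L system over the alphabet `A`: a morphism of the free monoid `A*` and a non-empty finite
set of non-empty words, the axioms. -/
structure DF0LSystem (A : Type*) where
  /-- The morphism `A* → A*`. -/
  φ : FreeMonoid A →* FreeMonoid A
  /-- The set of axioms. -/
  W : Finset (FreeMonoid A)
  nonempty_W : W.Nonempty
  ne_one_of_mem_W : ∀ w ∈ W, w ≠ 1

namespace DF0LSystem

variable {A : Type*} (S : DF0LSystem A)

/-- A PDF0L system is a DF0L system whose morphism is non-erasing. -/
def IsPDF0L : Prop :=
  ∀ a : A, S.φ (FreeMonoid.of a) ≠ 1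

/-- The language of `S`: the factors of the words obtained from the axioms by iterating the
morphism. -/
def language : Set (FreeMonoid A) :=
  {u | ∃ k : ℕ, ∃ w ∈ S.W, ∃ x y : FreeMonoid A, S.φ^[k] w = x * u * y}

/-- `(s, w, t)` is an interpretation of `u` in `S`. -/
def IsInterpretation (u s w t : FreeMonoid A) : Prop :=
  S.φ w = s * u * t ∧ w ∈ S.language

/-- `(w', w'')` is a factorization of `w` that induces the pair `(u', u'')` on the interpretation
`(s, w, t)` of `u' * u''`. -/
def IsSplitting (u' u'' s w t w' w'' : FreeMonoid A) : Prop :=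
  w' * w'' = w ∧ S.φ w' = s * u' ∧ S.φ w'' = u'' * t

/-- The pair `(u', u'')` is compatible with the interpretation `(s, w, t)` of `u' * u''`. -/
def IsCompatible (u' u'' s w t : FreeMonoid A) : Prop :=
  ∃ w' w'' : FreeMonoid A, S.IsSplitting u' u'' s w t w' w''

/-- The pair `(u', u'')` is compatible with at least one interpretation of `u' * u''`. -/
def IsAdmissible (u' u'' : FreeMonoid A) : Prop :=
  ∃ s w t : FreeMonoid A, S.IsInterpretation (u' * u'') s w t ∧ S.IsCompatible u' u'' s w t

/-- The pair `(u', u'')` is compatible with all interpretations of `u' * u''`. -/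
def IsWeaklySynchronizing (u' u'' : FreeMonoid A) : Prop :=
  ∀ s w t : FreeMonoid A, S.IsInterpretation (u' * u'') s w t → S.IsCompatible u' u'' s w t

/-- The word `u` is weakly synchronized: some factorization of it is a weakly synchronizing
pair. -/
def IsWeaklySynchronized (u : FreeMonoid A) : Prop :=
  ∃ u' u'' : FreeMonoid A, u = u' * u'' ∧ S.IsWeaklySynchronizing u' u''

/-- The pair `(u', u'')`, with `u'` non-empty, is compatible with all interpretations of
`u' * u''`, in such a way that the left factor `w'` always ends with the same letter. -/
def IsStronglySynchronizing (u' u'' : FreeMonoid A) : Prop :=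
  u' ≠ 1 ∧ ∃ a : A, ∀ s w t : FreeMonoid A, S.IsInterpretation (u' * u'') s w t →
    ∃ w' w'' : FreeMonoid A, S.IsSplitting u' u'' s w t w' w'' ∧
      ∃ x : FreeMonoid A, w' = x * FreeMonoid.of a

/-- All long enough words of the language are weakly synchronized. -/
def IsWeaklyCircular : Prop :=
  ∃ D : ℕ, ∀ u ∈ S.language, D < u.length → S.IsWeaklySynchronized u

/-- All admissible pairs of long enough words are strongly synchronizing. -/
def IsStronglyCircular : Prop :=
  ∃ D : ℕ, ∀ u' u'' : FreeMonoid A, S.IsAdmissible u' u'' → D < u'.length → D < u''.length →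
    S.IsStronglySynchronizing u' u''

/-- A word is bounded if the lengths of its iterated images are bounded. For a non-erasing morphism
these lengths are non-decreasing in `k`, so this says that their limit is finite. -/
def IsBoundedWord (w : FreeMonoid A) : Prop :=
  ∃ C : ℕ, ∀ k : ℕ, (S.φ^[k] w).length ≤ C

/-- Some unbounded word of the language has all its powers in the language. -/
def IsUnboundedlyRepetitive : Prop :=
  ∃ v ∈ S.language, ¬ S.IsBoundedWord v ∧ ∀ k : ℕ, v ^ k ∈ S.language

end DF0LSystem

/-!
The first part rests on a defect theorem. Among all alphabets `F` of non-empty words over which some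
power `φ ^ n` factors, choose one with the fewest elements. The words `φ c`, `c ∈ F`, then do not
factor over any smaller alphabet (`DF0LSystem.exists_incompressible`). Long words of the language
have ancestors of order `n`, so every interpretation of a long word `u` induces a factorization of
`u` into blocks `φ c`, up to incomplete blocks at the ends, all of whose cuts are cuts of the
interpretation. It suffices to find a cut that all these block structures share.

Given two block structures of `u`, look at the cuts of one of them and at the overhang there, the
word up to the next cut of the other. By the defect theorem
(`exists_factorsOver_of_relations`), applied to the blocks together with the overhang as
an additional letter, an overhang determines the letter that follows: two different continuations
would make the blocks factor over a smaller alphabet. So if an overhang is repeated, then `u` is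
periodic from there on until the first common cut (`Incompressible.take_eq_or_common_cut`), and as
there are only finitely many overhangs, `u` contains a high power of a short word unless the two
structures have a common cut near the beginning. Behind a common cut the defect theorem makes them
agree (`Incompressible.prefix_of_common_cut`). Hence long words that are not weakly synchronized
contain high powers of short words. These are unbounded, because long bounded words are weakly
synchronized: deep inside a bounded word of the language, all letters have images of length one
(`DF0LSystem.exists_length_img_eq_one`).

For the second part, suppose that the system is strongly circular and all powers of an unbounded word
`z` belong to the language. A cut inside a high power of `z` is strongly synchronizing, hence it
recurs one period later, and the preimages to the left of both cuts agree for a long stretch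
(`DF0LSystem.exists_common_suffix`). So the preimage is periodic as well: there is a word `y` with all
powers in the language such that `φ y` is a conjugate of `z`
(`DF0LSystem.exists_desubstitution`). If `z` has minimal length, then `y` has the same length, and
iterating this gives words `y` of that length with `φ ^ j y` of that length, for every `j`. As these
words are unbounded and there are only finitely many of them, this is absurd.
-/

/-! ### Words over an alphabet of words -/

/-- `u` is a concatenation of words of `F`. -/
def FactorsOver {A : Type*} (F : Set (List A)) (u : List A) : Prop :=
  ∃ l : List (List A), (∀ y ∈ l, y ∈ F) ∧ l.flatten = u

namespace FactorsOver

variable {A B : Type*} {F : Set (List A)}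

theorem of_mem {u : List A} (h : u ∈ F) : FactorsOver F u :=
  ⟨[u], by simpa using h, by simp⟩

theorem nil : FactorsOver F ([] : List A) := ⟨[], by simp, rfl⟩

theorem append {u v : List A} (hu : FactorsOver F u) (hv : FactorsOver F v) :
    FactorsOver F (u ++ v) := by
  obtain ⟨l, hl, rfl⟩ := hu
  obtain ⟨m, hm, rfl⟩ := hv
  refine ⟨l ++ m, ?_, by simp⟩
  intro y hy
  rcases List.mem_append.1 hy with h | h
  exacts [hl y h, hm y h]

theorem flatMap {g : B → List A} (h : ∀ b, FactorsOver F (g b)) (w : List B) :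
    FactorsOver F (w.flatMap g) := by
  induction w with
  | nil => exact nil
  | cons b w ih => simpa using (h b).append ih

end FactorsOver

/-- A list of factors that ranges over a set can be read as a word over that set, viewed as an
alphabet. -/
theorem FactorsOver.exists_word {A : Type*} {F : Set (List A)} {u : List A}
    (h : FactorsOver F u) : ∃ Z : List F, Z.flatMap Subtype.val = u := by
  obtain ⟨l, hl, rfl⟩ := h
  refine ⟨l.attachWith (· ∈ F) hl, ?_⟩
  simp [List.flatMap_def]

/-! ### A finitary defect theorem -/

section Defect

variable {A X : Type*} [DecidableEq X]

/-- If `σ b = σ a ++ r`, then `σ` factors through the substitution `b ↦ a b`, followed by the morphism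
that agrees with `σ` except that it maps `b` to `r`. -/
theorem flatMap_flatMap_split (σ : X → List A) {a b : X} {r : List A} (hab : a ≠ b)
    (hr : σ b = σ a ++ r) (Y : List X) :
    (Y.flatMap fun x => if x = b then [a, b] else [x]).flatMap (Function.update σ b r) =
      Y.flatMap σ := by
  rw [List.flatMap_assoc]
  congr 1
  funext x
  by_cases hx : x = b
  · subst hx; simp [hab, hr]
  · simp [hx]

/-- The defect theorem. Let `R` be a set of pairs of words over `X` whose `σ`-images agree on a prefix
that is at least as long as all the words `σ x` together. If the graph on `X` that joins the first
letters of the two words of each pair has at most `k` connected components, then the words `σ x`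
factor over at most `k` non-empty words. The bound on the number of components is expressed by the
hypothesis that a function which is constant along the edges takes at most `k` values.

If all edges join letters with the same image, the images themselves will do. Otherwise some edge
joins `a` and `b` with `σ b = σ a ++ r`, and `σ` is replaced by the morphism with `b ↦ r`, which has
smaller total length, while `b` is replaced by `a b` in all pairs. Removing the common first letter
`a` from the pair that gave the edge yields a pair that ties `b` to another letter, so the number of
components does not grow; the agreement of the images shrinks by `(σ a).length`, and so does the
total length. -/
theorem exists_factorsOver_of_relations [Fintype X] (k : ℕ) (N : ℕ) :
    ∀ (σ : X → List A) (R : Set (List X × List X)),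
    ∑ x, (σ x).length = N → (∀ x, σ x ≠ []) →
    (∀ Y Y', (Y, Y') ∈ R → ∃ z : List A, N ≤ z.length ∧
      z <+: Y.flatMap σ ∧ z <+: Y'.flatMap σ) →
    (∀ f : X → List A, (∀ a Y b Y', (a :: Y, b :: Y') ∈ R → f a = f b) →
      (Set.range f).ncard ≤ k) →
    ∃ F : Set (List A), F.Finite ∧ F.ncard ≤ k ∧ [] ∉ F ∧ ∀ x, FactorsOver F (σ x) := by
  induction N using Nat.strong_induction_on with
  | _ N ih =>
  intro σ R hN hσ hR hk
  by_cases hall : ∀ a Y b Y', (a :: Y, b :: Y') ∈ R → σ a = σ b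
  · refine ⟨Set.range σ, Set.finite_range σ, hk σ hall, ?_, fun x => .of_mem ⟨x, rfl⟩⟩
    rintro ⟨x, hx⟩
    exact hσ x hx
  · -- A relation whose first letters `a`, `b` have different images, the one of `a` being shorter.
    have key : ∃ a Y b Y', ((a :: Y, b :: Y') ∈ R ∨ (b :: Y', a :: Y) ∈ R) ∧ σ a ≠ σ b ∧
        (σ a).length ≤ (σ b).length := by
      push Not at hall
      obtain ⟨a, Y, b, Y', h, hne⟩ := hall
      rcases le_total (σ a).length (σ b).length with hl | hl
      · exact ⟨a, Y, b, Y', .inl h, hne, hl⟩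
      · exact ⟨b, Y', a, Y, .inr h, hne.symm, hl⟩
    obtain ⟨a, Y, b, Y', hmem, hne, hle⟩ := key
    have hab : a ≠ b := fun h => hne (by rw [h])
    obtain ⟨z, hzN, hz1, hz2⟩ : ∃ z : List A, N ≤ z.length ∧
        z <+: (a :: Y).flatMap σ ∧ z <+: (b :: Y').flatMap σ := by
      rcases hmem with h | h
      · exact hR _ _ h
      · obtain ⟨z, h0, h1, h2⟩ := hR _ _ h
        exact ⟨z, h0, h2, h1⟩
    have hsum : (σ a).length + (σ b).length ≤ N := by
      rw [← hN, ← Finset.sum_pair (f := fun x => (σ x).length) hab]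
      exact Finset.sum_le_sum_of_subset (Finset.subset_univ _)
    rw [List.flatMap_cons] at hz1 hz2
    have ha : σ a <+: z := List.prefix_of_prefix_length_le (List.prefix_append _ _) hz1 (by omega)
    have hb : σ b <+: z := List.prefix_of_prefix_length_le (List.prefix_append _ _) hz2 (by omega)
    obtain ⟨r, hr⟩ := List.prefix_of_prefix_length_le ha hb hle
    have hr0 : r ≠ [] := by rintro rfl; simp at hr; exact hne hr
    obtain ⟨z', rfl⟩ := ha
    have hz1' : z' <+: Y.flatMap σ := by simpa using hz1
    have hz2' : z' <+: r ++ Y'.flatMap σ := by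
      rw [← hr, List.append_assoc] at hz2
      exact (List.prefix_append_right_inj _).1 hz2
    set τ : X → List X := fun x => if x = b then [a, b] else [x] with hτ
    set σ' : X → List A := Function.update σ b r with hσ'
    have hτσ : ∀ Y : List X, (Y.flatMap τ).flatMap σ' = Y.flatMap σ :=
      flatMap_flatMap_split σ hab hr.symm
    have hlen : (σ b).length = (σ a).length + r.length := by simp [← hr]
    have hapos : 0 < (σ a).length := List.length_pos_iff.2 (hσ a)
    have hN' : ∑ x, (σ' x).length = N - (σ a).length := by
      have h1 : ∑ x, (σ x).length = (σ b).length + ∑ x ∈ Finset.univ.erase b, (σ x).length :=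
        (Finset.add_sum_erase _ _ (Finset.mem_univ b)).symm
      have h2 : ∑ x, (σ' x).length = (σ' b).length + ∑ x ∈ Finset.univ.erase b, (σ' x).length :=
        (Finset.add_sum_erase _ _ (Finset.mem_univ b)).symm
      have h3 : ∑ x ∈ Finset.univ.erase b, (σ' x).length =
          ∑ x ∈ Finset.univ.erase b, (σ x).length :=
        Finset.sum_congr rfl fun x hx => by
          rw [hσ', Function.update_of_ne (Finset.ne_of_mem_erase hx)]
      have h4 : σ' b = r := by simp [hσ']
      rw [h2, h3, h4]
      omega
    have hbY' : (b :: Y'.flatMap τ).flatMap σ' = r ++ Y'.flatMap σ := by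
      rw [List.flatMap_cons, hτσ]; simp [hσ']
    obtain ⟨F, hF, hFk, hF0, hfac⟩ := ih (N - (σ a).length) (by omega) σ'
      ({p | ∃ q ∈ R, p = (q.1.flatMap τ, q.2.flatMap τ)} ∪ {(Y.flatMap τ, b :: Y'.flatMap τ)})
      hN' (by
        intro x
        by_cases hx : x = b
        · subst hx; simpa [hσ'] using hr0
        · simpa [hσ', hx] using hσ x) (by
        rintro Z Z' (⟨q, hq, he⟩ | he)
        · simp only [Prod.mk.injEq] at he
          obtain ⟨rfl, rfl⟩ := he
          obtain ⟨z, h0, h1, h2⟩ := hR q.1 q.2 hq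
          exact ⟨z, by omega, by rwa [hτσ], by rwa [hτσ]⟩
        · simp only [Set.mem_singleton_iff, Prod.mk.injEq] at he
          obtain ⟨rfl, rfl⟩ := he
          refine ⟨z', ?_, by rwa [hτσ], by rwa [hbY']⟩
          simp only [List.length_append] at hzN
          omega) (by
        intro f' hf'
        -- The first letter of `τ x` is `x`, or `a` for `x = b`.
        have hhead : ∀ x, ∃ l, τ x = (if x = b then a else x) :: l := by
          intro x
          by_cases hx : x = b
          · exact ⟨[b], by simp [hτ, hx]⟩
          · exact ⟨[], by simp [hτ, hx]⟩
        set f : X → List A := fun x => f' (if x = b then a else x) with hf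
        have hfk := hk f (by
          intro c Z d Z' hcd
          obtain ⟨l, hl⟩ := hhead c
          obtain ⟨m, hm⟩ := hhead d
          refine hf' _ (l ++ Z.flatMap τ) _ (m ++ Z'.flatMap τ) (.inl ⟨_, hcd, ?_⟩)
          simp [hl, hm])
        refine (Set.ncard_le_ncard ?_ (Set.finite_range f)).trans hfk
        rintro _ ⟨x, rfl⟩
        by_cases hx : x = b
        · subst hx
          -- The shortened pair joins `b` to the first letter of `τ c`, which is not `b`.
          match Y, hz1' with
          | [], h =>
            simp only [List.flatMap_nil, List.prefix_nil] at h
            simp only [h, List.append_nil] at hzN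
            have := List.length_pos_iff.2 (hσ x)
            omega
          | c :: Y2, _ =>
            obtain ⟨l, hl⟩ := hhead c
            refine ⟨c, ?_⟩
            refine hf' _ (l ++ Y2.flatMap τ) _ (Y'.flatMap τ) (.inr ?_)
            simp [hl]
        · exact ⟨x, by simp [hf, hx]⟩)
    refine ⟨F, hF, hFk, hF0, fun x => ?_⟩
    have := FactorsOver.flatMap hfac (τ x)
    have h2 := hτσ [x]
    simp only [List.flatMap_singleton] at h2
    rwa [h2] at this

end Defect

/-! ### Overhangs of two block structures -/

section Blocks

variable {A X : Type*} {σ : X → List A}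

/-- Behind every prefix `m` of a word that consists of an incomplete block `v₀` and the blocks of `Y`,
the next cut comes after a word `v` of at most the length of a block. -/
theorem exists_overhang {m : List A} {T : ℕ} (hT : ∀ x, (σ x).length ≤ T) :
    ∀ {v₀ : List A} {Y : List X}, v₀.length ≤ T → m <+: v₀ ++ Y.flatMap σ →
    ∃ v Y₁ Y₂, Y = Y₁ ++ Y₂ ∧ m ++ v = v₀ ++ Y₁.flatMap σ ∧ v.length ≤ T := by
  intro v₀ Y
  induction Y generalizing m v₀ with
  | nil =>
    intro hv h
    obtain ⟨v, hv'⟩ := h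
    refine ⟨v, [], [], rfl, hv', ?_⟩
    have := congrArg List.length hv'
    simp only [List.length_append, List.flatMap_nil, List.length_nil] at this
    omega
  | cons c Y ih =>
    intro hv h
    rcases le_total m.length v₀.length with hl | hl
    · obtain ⟨v, rfl⟩ := List.prefix_of_prefix_length_le h (List.prefix_append _ _) hl
      refine ⟨v, [], c :: Y, rfl, by simp, ?_⟩
      simp only [List.length_append] at hv
      omega
    · obtain ⟨m', rfl⟩ := List.prefix_of_prefix_length_le (List.prefix_append _ _) h hl
      rw [List.prefix_append_right_inj, List.flatMap_cons] at h
      obtain ⟨v, Y₁, Y₂, rfl, e, hvT⟩ := ih (hT c) h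
      exact ⟨v, c :: Y₁, Y₂, rfl, by rw [List.flatMap_cons, List.append_assoc, e], hvT⟩

theorem length_le_length_flatMap (h0 : ∀ x, σ x ≠ []) (Y : List X) :
    Y.length ≤ (Y.flatMap σ).length := by
  induction Y with
  | nil => simp
  | cons a Y ih =>
    have hapos := List.length_pos_iff.2 (h0 a)
    simp only [List.flatMap_cons, List.length_append, List.length_cons]
    omega

theorem length_flatMap_le {T : ℕ} (hT : ∀ x, (σ x).length ≤ T) (Y : List X) :
    (Y.flatMap σ).length ≤ Y.length * T := by
  induction Y with
  | nil => simp
  | cons a Y ih =>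
    have := hT a
    simp only [List.flatMap_cons, List.length_append, List.length_cons, Nat.succ_mul]
    omega

end Blocks

section Overlap

/-- No alphabet with fewer letters than `X` suffices to write the images `σ x`: every finite
set of non-empty words over which all of them factor has at least `Nat.card X` elements. -/
def Incompressible {A X : Type*} (σ : X → List A) : Prop :=
  ∀ F : Set (List A), F.Finite → [] ∉ F → (∀ x, FactorsOver F (σ x)) → Nat.card X ≤ F.ncard

variable {A X : Type*} [Fintype X] {σ : X → List A}

theorem length_le_sum (σ : X → List A) (x : X) : (σ x).length ≤ ∑ x, (σ x).length :=
  Finset.single_le_sum (f := fun x => (σ x).length) (fun _ _ => Nat.zero_le _) (Finset.mem_univ x)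

/-- Two letters that take the same value leave fewer than `Nat.card X` values. -/
theorem ncard_range_lt {B : Type*} {f : X → B} {a b : X} (hab : a ≠ b) (h : f a = f b) :
    (Set.range f).ncard ≤ Nat.card X - 1 := by
  classical
  have : Set.range f ⊆ f '' {b}ᶜ := by
    rintro _ ⟨x, rfl⟩
    by_cases hx : x = b
    · exact ⟨a, hab, by rw [hx, h]⟩
    · exact ⟨x, hx, rfl⟩
  calc (Set.range f).ncard ≤ (f '' {b}ᶜ).ncard := Set.ncard_le_ncard this (Set.toFinite _)
    _ ≤ ({b}ᶜ : Set X).ncard := Set.ncard_image_le (Set.toFinite _)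
    _ = Nat.card X - 1 := by rw [Set.ncard_compl, Set.ncard_singleton]

namespace Incompressible

/-- Two words whose images agree for long enough start with the same letter. -/
theorem head_eq (hσ : Incompressible σ) (h0 : ∀ x, σ x ≠ []) {a b : X} {Y Y' : List X}
    {z : List A} (hz : ∑ x, (σ x).length ≤ z.length) (h1 : z <+: (a :: Y).flatMap σ)
    (h2 : z <+: (b :: Y').flatMap σ) : a = b := by
  classical
  by_contra hab
  obtain ⟨F, hF, hFk, hF0, hfac⟩ := exists_factorsOver_of_relations (Nat.card X - 1) _ σ
    {(a :: Y, b :: Y')} rfl h0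
    (by
      rintro Z Z' h
      simp only [Set.mem_singleton_iff, Prod.mk.injEq] at h
      obtain ⟨rfl, rfl⟩ := h
      exact ⟨z, hz, h1, h2⟩)
    (fun f hf => ncard_range_lt hab (hf a Y b Y' rfl))
  have := hσ F hF hF0 hfac
  have hpos : 0 < Nat.card X := Nat.card_pos_iff.2 ⟨⟨a⟩, inferInstance⟩
  omega

/-- An overhang `v` determines the letter that follows on the other side: two different letters,
together with `v` regarded as an additional letter, would give two independent relations. -/
theorem head_eq_of_overhang (hσ : Incompressible σ) (h0 : ∀ x, σ x ≠ []) {v : List A}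
    (hv : v ≠ []) {a b : X} {Y Y' Z Z' : List X} {x y : List A}
    (hx : v.length + ∑ x, (σ x).length ≤ x.length)
    (hy : v.length + ∑ x, (σ x).length ≤ y.length)
    (h1 : x <+: (a :: Y).flatMap σ) (h2 : x <+: v ++ Y'.flatMap σ)
    (h3 : y <+: (b :: Z).flatMap σ) (h4 : y <+: v ++ Z'.flatMap σ) : a = b := by
  classical
  by_contra hab
  let σ' : Option X → List A := fun o => o.elim v σ
  have hsome : ∀ W : List X, (W.map some).flatMap σ' = W.flatMap σ := by
    intro W; simp [List.flatMap_map, σ']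
  have hcons : ∀ W : List X, (none :: W.map some).flatMap σ' = v ++ W.flatMap σ := by
    intro W; rw [List.flatMap_cons, hsome]; rfl
  obtain ⟨F, hF, hFk, hF0, hfac⟩ := exists_factorsOver_of_relations (Nat.card X - 1) _ σ'
    {((a :: Y).map some, none :: Y'.map some), ((b :: Z).map some, none :: Z'.map some)} rfl
    (by rintro (_ | x); exacts [hv, h0 x])
    (by
      have hs : ∑ o, (σ' o).length = v.length + ∑ x, (σ x).length := by
        rw [Fintype.sum_option]; rfl
      rintro U U' (h | h)
      · simp only [Prod.mk.injEq] at h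
        obtain ⟨rfl, rfl⟩ := h
        exact ⟨x, by rw [hs]; exact hx, by rwa [hsome], by rwa [hcons]⟩
      · simp only [Set.mem_singleton_iff, Prod.mk.injEq] at h
        obtain ⟨rfl, rfl⟩ := h
        exact ⟨y, by rw [hs]; exact hy, by rwa [hsome], by rwa [hcons]⟩)
    (by
      intro f hf
      have ha : f (some a) = f none := hf _ (Y.map some) _ (Y'.map some) (.inl rfl)
      have hb : f (some b) = f none := hf _ (Z.map some) _ (Z'.map some) (.inr rfl)
      refine le_trans (Set.ncard_le_ncard ?_ (Set.toFinite _))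
        (ncard_range_lt (f := fun x => f (some x)) hab (ha.trans hb.symm))
      rintro _ ⟨o, rfl⟩
      cases o with
      | none => exact ⟨a, ha⟩
      | some x => exact ⟨x, rfl⟩)
  have := hσ F hF hF0 fun x => hfac (some x)
  have hpos : 0 < Nat.card X := Nat.card_pos_iff.2 ⟨⟨a⟩, inferInstance⟩
  omega

/-- Two positions with the same overhang `v` are followed by the same word, up to the first cut
that is common to both factorizations at the first position. -/
theorem take_eq_or_common_cut (hσ : Incompressible σ) (h0 : ∀ x, σ x ≠ []) (L : ℕ) :
    ∀ {v : List A} {Y Y' Z Z' : List X} {x y : List A}, v ≠ [] →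
    v.length ≤ ∑ x, (σ x).length →
    L + 2 * ∑ x, (σ x).length ≤ x.length → L + 2 * ∑ x, (σ x).length ≤ y.length →
    x <+: Y.flatMap σ → x <+: v ++ Y'.flatMap σ → y <+: Z.flatMap σ → y <+: v ++ Z'.flatMap σ →
    x.take L = y.take L ∨ ∃ Y₁ Y₂ Y₁' Y₂', Y = Y₁ ++ Y₂ ∧ Y' = Y₁' ++ Y₂' ∧
      Y₁.flatMap σ = v ++ Y₁'.flatMap σ ∧ (Y₁.flatMap σ).length ≤ L := by
  induction L using Nat.strong_induction_on with
  | _ L ih =>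
  intro v Y Y' Z Z' x y hv hvl hx hy h1 h2 h3 h4
  have hvpos := List.length_pos_iff.2 hv
  obtain ⟨x', rfl⟩ : v <+: x :=
    List.prefix_of_prefix_length_le (List.prefix_append _ _) h2 (by omega)
  obtain ⟨y', rfl⟩ : v <+: y :=
    List.prefix_of_prefix_length_le (List.prefix_append _ _) h4 (by omega)
  rcases le_or_gt L v.length with hL | hL
  · left
    rw [List.take_append_of_le_length hL, List.take_append_of_le_length hL]
  have h2' := (List.prefix_append_right_inj _).1 h2
  have h4' := (List.prefix_append_right_inj _).1 h4
  match Y, h1, Z, h3 with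
  | [], h1, _, _ => simp [hv] at h1
  | _ :: _, _, [], h3 => simp [hv] at h3
  | a :: Y, h1, b :: Z, h3 =>
    obtain rfl : a = b :=
      hσ.head_eq_of_overhang h0 hv (by omega) (by omega) h1 h2 h3 h4
    rw [List.flatMap_cons] at h1 h3
    have hal := length_le_sum σ a
    have hapos := List.length_pos_iff.2 (h0 a)
    have hax : σ a <+: v ++ x' :=
      List.prefix_of_prefix_length_le (List.prefix_append _ _) h1 (by omega)
    rcases lt_trichotomy (σ a).length v.length with hlt | heq | hgt
    -- The block of `a` ends inside the overhang, the same side is extended further.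
    · obtain ⟨v', rfl⟩ : σ a <+: v :=
        List.prefix_of_prefix_length_le hax (List.prefix_append _ _) hlt.le
      simp only [List.append_assoc, List.length_append, List.prefix_append_right_inj] at *
      rcases ih (L - (σ a).length) (by omega) (v := v') (x := v' ++ x') (y := v' ++ y')
        (by rintro rfl; simp at hlt) (by omega) (by simp only [List.length_append]; omega)
        (by simp only [List.length_append]; omega) h1
        ((List.prefix_append_right_inj _).2 h2) h3 ((List.prefix_append_right_inj _).2 h4) with h | h
      · left
        rw [List.take_append (l₁ := σ a), List.take_append (l₁ := σ a), h]
      · right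
        obtain ⟨Y₁, Y₂, Y₁', Y₂', rfl, rfl, e, hl⟩ := h
        refine ⟨a :: Y₁, Y₂, Y₁', Y₂', rfl, rfl, by rw [List.flatMap_cons, e], ?_⟩
        simp only [List.flatMap_cons, List.length_append]
        omega
    · right
      have : σ a = v :=
        (List.prefix_of_prefix_length_le hax (List.prefix_append _ _) heq.le).eq_of_length heq
      exact ⟨[a], Y, [], Y', rfl, rfl, by simp [this], by simp; omega⟩
    -- The block of `a` passes the overhang, the two sides swap their roles.
    · obtain ⟨v', hv'⟩ : v <+: σ a :=
        List.prefix_of_prefix_length_le (List.prefix_append _ _) hax hgt.le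
      have hll : v.length + v'.length = (σ a).length := by rw [← hv', List.length_append]
      simp only [← hv', List.append_assoc, List.prefix_append_right_inj] at h1 h3
      simp only [List.length_append] at hx hy
      rcases ih (L - v.length) (by omega) (v := v') (x := x') (y := y')
        (by rintro rfl; simp at hll; omega) (by omega) (by omega)
        (by omega) h2' h1 h4' h3 with h | h
      · left
        rw [List.take_append, List.take_append, h]
      · right
        obtain ⟨Y₁', Y₂', Y₁, Y₂, rfl, rfl, e, hl⟩ := h
        refine ⟨a :: Y₁, Y₂, Y₁', Y₂', rfl, rfl, ?_, ?_⟩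
        · rw [List.flatMap_cons, e, ← hv', List.append_assoc]
        · rw [List.flatMap_cons, ← hv', List.append_assoc, ← e, List.length_append]
          omega

/-- Past a common cut, two factorizations have the same cuts. -/
theorem prefix_of_common_cut (hσ : Incompressible σ) (h0 : ∀ x, σ x ≠ []) :
    ∀ {Y₁ Y₂ Y' : List X} {x : List A},
    (Y₁.flatMap σ).length + ∑ x, (σ x).length ≤ x.length →
    x <+: (Y₁ ++ Y₂).flatMap σ → x <+: Y'.flatMap σ → Y₁ <+: Y' := by
  intro Y₁
  induction Y₁ with
  | nil => intro _ _ _ _ _ _; exact List.nil_prefix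
  | cons a Y₁ ih =>
    intro Y₂ Y' x hx h1 h2
    have hapos := List.length_pos_iff.2 (h0 a)
    simp only [List.flatMap_cons, List.length_append] at hx
    match Y', h2 with
    | [], h2 =>
      simp only [List.flatMap_nil, List.prefix_nil] at h2
      simp only [h2, List.length_nil] at hx
      omega
    | b :: Y', h2 =>
      obtain rfl : a = b := hσ.head_eq h0 (by omega) h1 h2
      simp only [List.cons_append, List.flatMap_cons] at h1 h2
      obtain ⟨x', rfl⟩ : σ a <+: x :=
        List.prefix_of_prefix_length_le (List.prefix_append _ _) h1 (by omega)
      rw [List.prefix_append_right_inj] at h1 h2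
      rw [List.length_append] at hx
      exact List.cons_prefix_cons.2 ⟨rfl, ih (by omega) h1 h2⟩

end Incompressible

end Overlap

/-- A word that agrees with its shift by `d` on a long stretch starts with a power of its prefix of
length `d`. -/
theorem replicate_prefix_of_take_eq {A : Type*} {d : ℕ} {k L : ℕ} : ∀ {x : List A},
    k * d ≤ L → k * d ≤ x.length → x.take L = (x.drop d).take L →
    (List.replicate k (x.take d)).flatten <+: x := by
  induction k generalizing L with
  | zero => intro x _ _ _; simp
  | succ k ih =>
    intro x hL hx h
    rw [Nat.succ_mul] at hL hx
    have hlast : (List.replicate k ((x.drop d).take d)).flatten <+: x.drop d := by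
      refine ih (L := L - d) (by omega) (by simp; omega) ?_
      have := congrArg (List.drop d) h
      simpa only [List.drop_take] using this
    rw [List.replicate_succ, List.flatten_cons]
    rcases Nat.eq_zero_or_pos k with rfl | hk
    · simpa using List.take_prefix _ _
    · have hd : d ≤ k * d := Nat.le_mul_of_pos_left d hk
      have h2 : (x.drop d).take d = x.take d := by
        have := congrArg (List.take d) h
        simp only [List.take_take] at this
        rw [min_eq_left (by omega)] at this
        exact this.symm
      rw [h2] at hlast
      conv_rhs => rw [← List.take_append_drop d x]
      exact (List.prefix_append_right_inj _).2 hlast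

/-! ### Common cuts of long words -/

section CommonCut

variable {A X : Type*} [Finite A] [Fintype X] {σ : X → List A}

/-- Two block structures of a long word either have a common cut near the beginning or force a high
power of a short word there. -/
theorem Incompressible.exists_common_cut_or_power (hσ : Incompressible σ) (h0 : ∀ x, σ x ≠ [])
    (k : ℕ) {T K : ℕ} (hT : T = ∑ x, (σ x).length) (hK : K = {l : List A | l.length ≤ T}.ncard)
    {u v v' : List A} {Y Y' : List X} (hu : (K + 1) * T + k * ((K + 1) * T) + 2 * T < u.length)
    (hv : v.length ≤ T) (hv' : v'.length ≤ T) (h1 : u <+: v ++ Y.flatMap σ)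
    (h2 : u <+: v' ++ Y'.flatMap σ) :
    (∃ z, z ≠ [] ∧ z.length ≤ (K + 1) * T ∧ (List.replicate k z).flatten <:+: u) ∨
    ∃ Y₁ Y₂ Y₁' Y₂', Y = Y₁ ++ Y₂ ∧ Y' = Y₁' ++ Y₂' ∧
      v ++ Y₁.flatMap σ = v' ++ Y₁'.flatMap σ ∧
      (v ++ Y₁.flatMap σ).length ≤ (K + 1) * T + k * ((K + 1) * T) := by
  have hσT : ∀ x, (σ x).length ≤ T := fun x => hT ▸ length_le_sum σ x
  have hmlen : ∀ n ≤ K, (v ++ (Y.take n).flatMap σ).length ≤ (K + 1) * T := by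
    intro n hn
    have h3 := length_flatMap_le hσT (Y.take n)
    have h4 : (Y.take n).length * T ≤ K * T :=
      Nat.mul_le_mul_right T ((List.length_take_le n Y).trans hn)
    rw [List.length_append, Nat.succ_mul]
    omega
  have hYlen : K < Y.length := by
    by_contra hlt
    have h3 := h1.length_le
    have h4 := hmlen Y.length (by omega)
    rw [List.take_length] at h4
    omega
  have hmu : ∀ n ≤ K, v ++ (Y.take n).flatMap σ <+: u := by
    intro n hn
    refine List.prefix_of_prefix_length_le ?_ h1 ((hmlen n hn).trans (by omega))
    conv_rhs => rw [← List.take_append_drop n Y, List.flatMap_append, ← List.append_assoc]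
    exact List.prefix_append _ _
  have hover : ∀ n : ℕ, ∃ w Y₁' Y₂', n ≤ K → Y' = Y₁' ++ Y₂' ∧
      (v ++ (Y.take n).flatMap σ) ++ w = v' ++ Y₁'.flatMap σ ∧ w.length ≤ T := by
    intro n
    by_cases hn : n ≤ K
    · obtain ⟨w, Y₁', Y₂', h⟩ := exists_overhang hσT hv' ((hmu n hn).trans h2)
      exact ⟨w, Y₁', Y₂', fun _ => h⟩
    · exact ⟨[], [], [], fun h => absurd h hn⟩
  choose w Y₁' Y₂' hw using hover
  have hfin : {l : List A | l.length ≤ T}.Finite := List.finite_length_le A T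
  -- Two cuts of the first structure with the same overhang of the second one.
  obtain ⟨i, j, hij, hj, hwij⟩ : ∃ i j, i < j ∧ j ≤ K ∧ w i = w j := by
    have hcard : hfin.toFinset.card < (Finset.range (K + 1)).card := by
      rw [Finset.card_range, hK, Set.ncard_eq_toFinset_card _ hfin]
      exact Nat.lt_succ_self _
    obtain ⟨i, hi, j, hj, hne, he⟩ := Finset.exists_ne_map_eq_of_card_lt_of_maps_to hcard
      (f := w) (by
        intro n hn
        simp only [Finset.coe_range, Set.mem_Iio] at hn
        simpa using (hw n (by omega)).2.2)
    simp only [Finset.mem_range] at hi hj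
    rcases hne.lt_or_gt with h | h
    · exact ⟨i, j, h, by omega, he⟩
    · exact ⟨j, i, h, by omega, he.symm⟩
  obtain ⟨hYi, hei, hwT⟩ := hw i (by omega)
  obtain ⟨hYj, hej, -⟩ := hw j hj
  by_cases hwi : w i = []
  · right
    rw [hwi, List.append_nil] at hei
    exact ⟨Y.take i, Y.drop i, Y₁' i, Y₂' i, (List.take_append_drop _ _).symm, hYi, hei,
      (hmlen i (by omega)).trans (Nat.le_add_right _ _)⟩
  have split : ∀ n ≤ K, ∀ x, v ++ (Y.take n).flatMap σ ++ x = u →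
      x <+: (Y.drop n).flatMap σ ∧ x <+: w n ++ (Y₂' n).flatMap σ := by
    intro n hn x hx
    obtain ⟨hYn, hen, -⟩ := hw n hn
    rw [← hx] at h1 h2
    rw [← List.take_append_drop n Y, List.flatMap_append, ← List.append_assoc,
      List.take_append_drop, List.prefix_append_right_inj] at h1
    rw [hYn, List.flatMap_append, ← List.append_assoc, ← hen, List.append_assoc (_ ++ _) (w n),
      List.prefix_append_right_inj] at h2
    exact ⟨h1, h2⟩
  obtain ⟨y, hy⟩ := hmu j hj
  -- The word between the two positions.
  obtain ⟨e, he⟩ : ∃ e, e = ((Y.drop i).take (j - i)).flatMap σ := ⟨_, rfl⟩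
  have hmj : v ++ (Y.take j).flatMap σ = v ++ (Y.take i).flatMap σ ++ e := by
    rw [he, List.append_assoc, ← List.flatMap_append, ← List.take_add, Nat.add_sub_cancel' hij.le]
  have hepos : 0 < e.length := by
    have := length_le_length_flatMap h0 ((Y.drop i).take (j - i))
    rw [← he, List.length_take, List.length_drop] at this
    omega
  have hele : e.length ≤ (K + 1) * T := by
    have := hmlen j hj
    rw [hmj, List.length_append] at this
    omega
  have hxu : v ++ (Y.take i).flatMap σ ++ (e ++ y) = u := by
    rw [← hy, hmj, List.append_assoc _ e]
  have hylen : k * ((K + 1) * T) + 2 * T ≤ y.length := by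
    have h3 := hmlen j hj
    rw [← hy, List.length_append] at hu
    omega
  obtain ⟨s1, s2⟩ := split i (by omega) _ hxu
  obtain ⟨s3, s4⟩ := split j hj _ hy
  rw [← hwij] at s4
  subst hT
  rcases hσ.take_eq_or_common_cut h0 (k * ((K + 1) * _)) hwi hwT
    (by rw [List.length_append]; omega) hylen s1 s2 s3 s4 with h | h
  · left
    refine ⟨e, List.length_pos_iff.1 hepos, hele, ?_⟩
    have := replicate_prefix_of_take_eq (x := e ++ y) (d := e.length) (k := k)
      (Nat.mul_le_mul_left k hele)
      ((Nat.mul_le_mul_left k hele).trans (by rw [List.length_append]; omega))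
      (by rw [List.drop_left]; exact h)
    rw [List.take_left] at this
    refine this.isInfix.trans ?_
    rw [← hxu]
    exact (List.suffix_append _ _).isInfix
  · right
    obtain ⟨Z₁, Z₂, Z₁', Z₂', e1, e2, e3, hl⟩ := h
    refine ⟨Y.take i ++ Z₁, Z₂, Y₁' i ++ Z₁', Z₂', ?_, ?_, ?_, ?_⟩
    · rw [List.append_assoc, ← e1, List.take_append_drop]
    · rw [List.append_assoc, ← e2, ← hYi]
    · rw [List.flatMap_append, List.flatMap_append, e3, ← List.append_assoc v', ← hei]
      simp only [List.append_assoc]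
    · have := hmlen i (by omega)
      rw [List.flatMap_append, ← List.append_assoc, List.length_append]
      omega

/-- Every long word that contains no high power of a short word has a position at which every one
of its block structures has a cut. -/
theorem Incompressible.exists_cut_or_power (hσ : Incompressible σ) (h0 : ∀ x, σ x ≠ []) {T : ℕ}
    (hT : T = ∑ x, (σ x).length) : ∃ P : ℕ, ∀ k : ℕ, ∃ B : ℕ, ∀ u : List A, B ≤ u.length →
    (∃ z, z ≠ [] ∧ z.length ≤ P ∧ (List.replicate k z).flatten <:+: u) ∨
    ∃ u₁ u₂, u = u₁ ++ u₂ ∧ ∀ (v : List A) (Y : List X), v.length ≤ T → u <+: v ++ Y.flatMap σ →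
      ∃ Y₁ Y₂, Y = Y₁ ++ Y₂ ∧ u₁ = v ++ Y₁.flatMap σ := by
  obtain ⟨K, hK⟩ : ∃ K, K = {l : List A | l.length ≤ T}.ncard := ⟨_, rfl⟩
  refine ⟨(K + 1) * T, fun k => ?_⟩
  obtain ⟨C, hC⟩ : ∃ C, C = (K + 1) * T + k * ((K + 1) * T) := ⟨_, rfl⟩
  refine ⟨C + 2 * T + C * T + 1, fun u hu => ?_⟩
  have hσT : ∀ x, (σ x).length ≤ T := fun x => hT ▸ length_le_sum σ x
  by_cases hpow : ∃ z, z ≠ [] ∧ z.length ≤ (K + 1) * T ∧ (List.replicate k z).flatten <:+: u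
  · exact .inl hpow
  right
  by_cases hex : ∃ (v : List A) (Y : List X), v.length ≤ T ∧ u <+: v ++ Y.flatMap σ
  · obtain ⟨v, Y, hv, hY⟩ := hex
    have hlen : (v ++ (Y.take C).flatMap σ).length ≤ T + C * T := by
      have h3 := length_flatMap_le hσT (Y.take C)
      have h4 : (Y.take C).length * T ≤ C * T := Nat.mul_le_mul_right T (List.length_take_le C Y)
      rw [List.length_append]
      omega
    have hYC : C ≤ Y.length := by
      by_contra hlt
      have := hY.length_le
      rw [List.take_of_length_le (by omega)] at hlen
      omega
    have hpre : v ++ (Y.take C).flatMap σ <+: v ++ Y.flatMap σ := by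
      conv_rhs => rw [← List.take_append_drop C Y, List.flatMap_append, ← List.append_assoc]
      exact List.prefix_append _ _
    obtain ⟨u₂, hu₂⟩ := List.prefix_of_prefix_length_le hpre hY (by omega)
    refine ⟨v ++ (Y.take C).flatMap σ, u₂, hu₂.symm, fun v' Y' hv' hY' => ?_⟩
    rcases hσ.exists_common_cut_or_power h0 k hT hK (by omega) hv hv' hY hY' with h | h
    · exact absurd h hpow
    obtain ⟨Y₁, Y₂, Y₁', Y₂', rfl, rfl, e, hl⟩ := h
    have hY₁ : Y₁.length ≤ C := by
      have := length_le_length_flatMap h0 Y₁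
      rw [List.length_append] at hl
      omega
    obtain ⟨Z₁, hZ₁⟩ : ∃ Z₁, Z₁ = Y₂.take (C - Y₁.length) := ⟨_, rfl⟩
    have htake : (Y₁ ++ Y₂).take C = Y₁ ++ Z₁ := by
      rw [List.take_append, List.take_of_length_le hY₁, hZ₁]
    rw [htake] at hu₂ hlen ⊢
    obtain ⟨Z₂, hZ₂⟩ : ∃ Z₂, Z₂ = Y₂.drop (C - Y₁.length) := ⟨_, rfl⟩
    have hY₂ : Y₂ = Z₁ ++ Z₂ := by rw [hZ₁, hZ₂, List.take_append_drop]
    have hux : u = (v ++ Y₁.flatMap σ) ++ (Z₁.flatMap σ ++ u₂) := by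
      rw [← hu₂, List.flatMap_append]; simp only [List.append_assoc]
    have hZpre : Z₁ <+: Y₂' := by
      refine hσ.prefix_of_common_cut h0 (Y₂ := Z₂) (x := Z₁.flatMap σ ++ u₂) ?_ ?_ ?_
      · have h5 := congrArg List.length hu₂
        rw [List.length_append] at h5
        rw [List.length_append, ← hT]
        omega
      · rw [hux, List.flatMap_append, ← List.append_assoc v, List.prefix_append_right_inj, hY₂] at hY
        exact hY
      · rw [hux, List.flatMap_append, ← List.append_assoc v', ← e,
          List.prefix_append_right_inj] at hY'
        exact hY'
    obtain ⟨Z₃, rfl⟩ := hZpre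
    refine ⟨Y₁' ++ Z₁, Z₃, by simp, ?_⟩
    rw [List.flatMap_append, List.flatMap_append, ← List.append_assoc, e, List.append_assoc]
  -- Without any block structure every position qualifies.
  · exact ⟨[], u, rfl, fun v Y hv hY => absurd ⟨v, Y, hv, hY⟩ hex⟩

end CommonCut

/-! ### Iterates, ancestors and weak synchronization -/

/-- The cuts of a non-erasing image are ordered as the prefixes they come from. -/
theorem prefix_of_length_flatMap_le {A B : Type*} {g : B → List A} (h0 : ∀ b, g b ≠ [])
    {x y w : List B} (hx : x <+: w) (hy : y <+: w)
    (h : (x.flatMap g).length ≤ (y.flatMap g).length) : x <+: y := by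
  rcases List.prefix_or_prefix_of_prefix hx hy with h1 | ⟨r, rfl⟩
  · exact h1
  · have h2 := length_le_length_flatMap h0 r
    rw [List.flatMap_append, List.length_append] at h
    have : r = [] := List.length_eq_zero_iff.1 (by omega)
    simp [this]

/-- A cut of the image of `x ++ w ++ y` that falls into the image of `w` is a cut of the latter. -/
theorem exists_split_of_prefix {A B : Type*} {g : B → List A} (h0 : ∀ b, g b ≠ [])
    {q x w y : List B} {s r : List A} (hq : q <+: x ++ w ++ y)
    (hqg : q.flatMap g = x.flatMap g ++ s) (hw : w.flatMap g = s ++ r) :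
    ∃ w₁ w₂, w = w₁ ++ w₂ ∧ w₁.flatMap g = s ∧ w₂.flatMap g = r := by
  obtain ⟨w₁, rfl⟩ : x <+: q := prefix_of_length_flatMap_le h0
    (by rw [List.append_assoc]; exact List.prefix_append _ _) hq (by simp [hqg])
  rw [List.flatMap_append, List.append_cancel_left_eq] at hqg
  rw [List.append_assoc, List.prefix_append_right_inj] at hq
  obtain ⟨w₂, rfl⟩ : w₁ <+: w := prefix_of_length_flatMap_le h0 hq (List.prefix_append _ _)
    (by rw [hqg, hw]; simp)
  rw [List.flatMap_append, hqg, List.append_cancel_left_eq] at hw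
  exact ⟨w₁, w₂, rfl, hqg, hw⟩

namespace FreeMonoid

theorem toList_pow {A : Type*} (v : FreeMonoid A) (k : ℕ) :
    toList (v ^ k) = (List.replicate k (toList v)).flatten := by
  induction k with
  | zero => rfl
  | succ k ih => rw [pow_succ', toList_mul, ih, List.replicate_succ, List.flatten_cons]

end FreeMonoid

namespace DF0LSystem

open FreeMonoid

variable {A : Type*} {S : DF0LSystem A}

/-- The image of a letter under the `n`-th power of the morphism, as a list. -/
def img (S : DF0LSystem A) (n : ℕ) (a : A) : List A :=
  toList (S.φ^[n] (of a))

theorem toList_iterate (S : DF0LSystem A) (n : ℕ) (w : FreeMonoid A) :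
    toList (S.φ^[n] w) = (toList w).flatMap (S.img n) := by
  induction w using FreeMonoid.recOn with
  | one => rw [iterate_map_one]; rfl
  | of_mul a w ih => rw [iterate_map_mul, toList_mul, ih]; rfl

theorem toList_φ (S : DF0LSystem A) (w : FreeMonoid A) :
    toList (S.φ w) = (toList w).flatMap (S.img 1) :=
  S.toList_iterate 1 w

theorem img_succ (S : DF0LSystem A) (n : ℕ) (a : A) :
    S.img (n + 1) a = (S.img n a).flatMap (S.img 1) := by
  rw [img, Function.iterate_succ_apply', toList_φ]; rfl

theorem img_ne_nil (hS : S.IsPDF0L) (n : ℕ) (a : A) : S.img n a ≠ [] := by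
  induction n with
  | zero => simp [img]
  | succ n ih =>
    rw [img_succ]
    have h1 := length_le_length_flatMap (σ := S.img 1) (fun b => hS b) (S.img n a)
    have h2 := List.length_pos_iff.2 ih
    exact List.length_pos_iff.1 (by omega)

theorem length_le_length_iterate (hS : S.IsPDF0L) (n : ℕ) (w : FreeMonoid A) :
    w.length ≤ (S.φ^[n] w).length := by
  change (toList w).length ≤ (toList (S.φ^[n] w)).length
  rw [toList_iterate]
  exact length_le_length_flatMap (img_ne_nil hS n) _

theorem mem_language_of_mul {u x y : FreeMonoid A} (h : x * u * y ∈ S.language) :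
    u ∈ S.language := by
  obtain ⟨k, w, hw, x', y', e⟩ := h
  exact ⟨k, w, hw, x' * x, y * y', by rw [e]; simp only [mul_assoc]⟩

theorem mem_language_of_infix {u v : FreeMonoid A} (h : toList u <:+: toList v)
    (hv : v ∈ S.language) : u ∈ S.language := by
  obtain ⟨x, y, e⟩ := h
  refine mem_language_of_mul (x := ofList x) (y := ofList y) ?_
  have : ofList x * u * ofList y = v := e
  rwa [this]

/-- Long words of the language have ancestors of every prescribed order. -/
theorem exists_ancestor (S : DF0LSystem A) (n : ℕ) : ∃ C, ∀ u ∈ S.language, C < u.length →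
    ∃ w ∈ S.language, ∃ x y, S.φ^[n] w = x * u * y := by
  refine ⟨∑ w ∈ S.W, ∑ k ∈ Finset.range n, (S.φ^[k] w).length, ?_⟩
  rintro u ⟨k, w, hw, x, y, e⟩ hu
  rcases lt_or_ge k n with hk | hk
  · exfalso
    have h1 : (S.φ^[k] w).length ≤ ∑ k ∈ Finset.range n, (S.φ^[k] w).length :=
      Finset.single_le_sum (f := fun k => (S.φ^[k] w).length) (fun _ _ => Nat.zero_le _)
        (Finset.mem_range.2 hk)
    have h2 : ∑ k ∈ Finset.range n, (S.φ^[k] w).length ≤ _ :=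
      Finset.single_le_sum (f := fun w => ∑ k ∈ Finset.range n, (S.φ^[k] w).length)
        (fun _ _ => Nat.zero_le _) hw
    rw [e, length_mul, length_mul] at h1
    omega
  · refine ⟨S.φ^[k - n] w, ⟨k - n, w, hw, 1, 1, by simp⟩, x, y, ?_⟩
    rw [← Function.iterate_add_apply, Nat.add_sub_cancel' hk, e]

/-- Weak synchronization in terms of lists. -/
theorem isWeaklySynchronized_of_split {u : FreeMonoid A} {u₁ u₂ : List A}
    (hu : toList u = u₁ ++ u₂)
    (h : ∀ s w t : List A, ofList w ∈ S.language →
      w.flatMap (S.img 1) = s ++ (u₁ ++ u₂) ++ t →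
      ∃ w₁ w₂, w = w₁ ++ w₂ ∧ w₁.flatMap (S.img 1) = s ++ u₁ ∧
        w₂.flatMap (S.img 1) = u₂ ++ t) :
    S.IsWeaklySynchronized u := by
  refine ⟨ofList u₁, ofList u₂, hu, ?_⟩
  rintro s w t ⟨hw, hL⟩
  have hw' : (toList w).flatMap (S.img 1) = toList s ++ (u₁ ++ u₂) ++ toList t := by
    rw [← toList_φ, hw]; rfl
  obtain ⟨w₁, w₂, e, e1, e2⟩ := h (toList s) (toList w) (toList t) hL hw'
  refine ⟨ofList w₁, ofList w₂, e.symm, ?_, ?_⟩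
  · apply toList.injective; rw [toList_φ]; exact e1
  · apply toList.injective; rw [toList_φ]; exact e2

theorem IsWeaklySynchronized.mul {u : FreeMonoid A} (h : S.IsWeaklySynchronized u)
    (x y : FreeMonoid A) : S.IsWeaklySynchronized (x * u * y) := by
  obtain ⟨u₁, u₂, rfl, h⟩ := h
  refine ⟨x * u₁, u₂ * y, by simp only [mul_assoc], ?_⟩
  rintro s w t ⟨hw, hL⟩
  obtain ⟨w₁, w₂, e, e1, e2⟩ := h (s * x) w (y * t) ⟨by rw [hw]; simp only [mul_assoc], hL⟩
  exact ⟨w₁, w₂, e, by rw [e1, mul_assoc], by rw [e2, mul_assoc]⟩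

theorem IsWeaklySynchronized.of_infix {u v : FreeMonoid A} (h : S.IsWeaklySynchronized u)
    (huv : toList u <:+: toList v) : S.IsWeaklySynchronized v := by
  obtain ⟨x, y, e⟩ := huv
  have : ofList x * u * ofList y = v := e
  exact this ▸ h.mul _ _

/-! ### Powers in words that are not weakly synchronized -/

/-- Some power `φ ^ n` of the morphism factors through an alphabet `F` of words that is smallest
among the alphabets through which any power factors. Then `φ` restricted to `F` is
incompressible. -/
theorem exists_incompressible [Finite A] (hS : S.IsPDF0L) : ∃ (n : ℕ) (F : Set (List A)),
    F.Finite ∧ [] ∉ F ∧ (∀ a, FactorsOver F (S.img n a)) ∧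
    Incompressible fun c : F => c.1.flatMap (S.img 1) := by
  classical
  have hex : ∃ r n, ∃ F : Set (List A), F.Finite ∧ [] ∉ F ∧ (∀ a, FactorsOver F (S.img n a)) ∧
      F.ncard = r := by
    refine ⟨_, 0, Set.range (S.img 0), Set.finite_range _, ?_, fun a => .of_mem ⟨a, rfl⟩, rfl⟩
    rintro ⟨a, ha⟩
    exact img_ne_nil hS 0 a ha
  obtain ⟨n, F, hF, hF0, hfac, hr⟩ := Nat.find_spec hex
  refine ⟨n, F, hF, hF0, hfac, fun G hG hG0 hGfac => ?_⟩
  rw [Nat.card_coe_set_eq, hr]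
  refine Nat.find_min' hex ⟨n + 1, G, hG, hG0, fun a => ?_, rfl⟩
  obtain ⟨Z, hZ⟩ := (hfac a).exists_word
  rw [img_succ, ← hZ, List.flatMap_assoc]
  exact FactorsOver.flatMap hGfac Z

/-- Long words of the language are weakly synchronized or contain high powers of short words. -/
theorem exists_power_or_isWeaklySynchronized [Finite A] (hS : S.IsPDF0L) :
    ∃ P : ℕ, ∀ k : ℕ, ∃ D : ℕ, ∀ u ∈ S.language, D < u.length →
      (∃ z, z ≠ [] ∧ z.length ≤ P ∧ (List.replicate k z).flatten <:+: toList u) ∨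
      S.IsWeaklySynchronized u := by
  obtain ⟨n, F, hF, hF0, hfac, hinc⟩ := exists_incompressible hS
  have := hF.fintype
  have := Fintype.ofFinite A
  have hg0 : ∀ a, S.img 1 a ≠ [] := img_ne_nil hS 1
  set σ : F → List A := fun c => c.1.flatMap (S.img 1) with hσ
  have hσ0 : ∀ c, σ c ≠ [] := by
    intro c hc
    have h1 := length_le_length_flatMap hg0 c.1
    have h2 : c.1.flatMap (S.img 1) = [] := hc
    rw [h2, List.length_nil, Nat.le_zero, List.length_eq_zero_iff] at h1
    exact hF0 (h1 ▸ c.2)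
  obtain ⟨P, hP⟩ := hinc.exists_cut_or_power hσ0 rfl
  refine ⟨P, fun k => ?_⟩
  obtain ⟨B, hB⟩ := hP k
  obtain ⟨C, hC⟩ := S.exists_ancestor n
  set M := ∑ a, (S.img 1 a).length with hM
  refine ⟨B + C * M, fun u _ hu => ?_⟩
  rcases hB (toList u) (by change B ≤ u.length; omega) with h | ⟨u₁, u₂, hu12, hcut⟩
  · exact .inl h
  refine .inr (isWeaklySynchronized_of_split hu12 fun s w t hw e => ?_)
  -- The word `w` is a factor of a word over `F`, whose blocks induce a block structure of `u`.
  have hwC : C < w.length := by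
    by_contra hle
    have h1 := length_flatMap_le (length_le_sum (S.img 1)) w
    have h2 : w.length * M ≤ C * M := Nat.mul_le_mul_right _ (by omega)
    have h3 : u.length = (u₁ ++ u₂).length := congrArg List.length hu12
    rw [← hM, e, List.length_append, List.length_append, ← h3] at h1
    omega
  obtain ⟨w', -, x, y, hxy⟩ := hC _ hw hwC
  obtain ⟨Z, hZ⟩ := (FactorsOver.flatMap hfac (toList w')).exists_word
  have hZw : Z.flatMap Subtype.val = toList x ++ w ++ toList y := by
    rw [hZ, ← toList_iterate, hxy]; rfl
  have hZσ : Z.flatMap σ = (toList x).flatMap (S.img 1) ++ s ++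
      (u₁ ++ u₂ ++ (t ++ (toList y).flatMap (S.img 1))) := by
    rw [hσ, ← List.flatMap_assoc, hZw, List.flatMap_append, List.flatMap_append, e]
    simp only [List.append_assoc]
  obtain ⟨v, Z₁, Z₂, rfl, hv, hvT⟩ := exists_overhang
    (m := (toList x).flatMap (S.img 1) ++ s) (length_le_sum σ) (v₀ := []) (Y := Z)
    (Nat.zero_le _) (by rw [List.nil_append, hZσ]; exact List.prefix_append _ _)
  rw [List.nil_append] at hv
  rw [List.flatMap_append, ← hv, List.append_assoc _ v, List.append_cancel_left_eq] at hZσ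
  obtain ⟨Y₁, Y₂, rfl, hu₁⟩ := hcut v Z₂ hvT (by rw [hu12, hZσ]; exact List.prefix_append _ _)
  have hq := exists_split_of_prefix hg0 (q := (Z₁ ++ Y₁).flatMap Subtype.val) (x := toList x)
    (w := w) (y := toList y) (s := s ++ u₁) (r := u₂ ++ t)
    (by rw [← hZw, ← List.append_assoc, List.flatMap_append (xs := Z₁ ++ Y₁)]
        exact List.prefix_append _ _)
    (by
      have : (Z₁ ++ Y₁).flatMap σ = (toList x).flatMap (S.img 1) ++ (s ++ u₁) := by
        rw [List.flatMap_append, ← hv, hu₁]; simp only [List.append_assoc]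
      rw [← this, hσ, List.flatMap_assoc])
    (by rw [e]; simp only [List.append_assoc])
  exact hq

end DF0LSystem

/-! ### Bounded words -/

/-- The letter whose image covers a given position of `w.flatMap g`. -/
theorem exists_covering_letter {A B : Type*} {g : B → List A} {c : A} {q : List A} :
    ∀ {w : List B} {p : List A}, w.flatMap g = p ++ c :: q → ∃ w₁ d w₂ r₁ r₂, w = w₁ ++ d :: w₂ ∧
      g d = r₁ ++ c :: r₂ ∧ p = w₁.flatMap g ++ r₁ ∧ q = r₂ ++ w₂.flatMap g := by
  intro w
  induction w with
  | nil => intro p h; simp at h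
  | cons b w ih =>
    intro p h
    rw [List.flatMap_cons] at h
    rcases List.append_eq_append_iff.1 h with ⟨p', rfl, h'⟩ | ⟨r, hr, h'⟩
    · obtain ⟨w₁, d, w₂, r₁, r₂, rfl, hd, rfl, rfl⟩ := ih h'
      exact ⟨b :: w₁, d, w₂, r₁, r₂, rfl, hd, by simp, rfl⟩
    · cases r with
      | nil =>
        obtain ⟨w₁, d, w₂, r₁, r₂, rfl, hd, hp, rfl⟩ := ih (p := []) (by simpa using h'.symm)
        refine ⟨b :: w₁, d, w₂, r₁, r₂, rfl, hd, ?_, rfl⟩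
        rw [List.flatMap_cons, List.append_assoc, ← hp, hr, List.append_nil, List.append_nil]
      | cons c' r =>
        rw [List.cons_append, List.cons.injEq] at h'
        obtain ⟨rfl, rfl⟩ := h'
        exact ⟨[], b, w, p, r, rfl, hr, by simp, rfl⟩

/-- A long factor that ends inside the image of a letter covers the images of many letters before
it. -/
theorem exists_suffix_images {A B : Type*} {g : B → List A} {M : ℕ} (hM : ∀ b, (g b).length ≤ M)
    {C : ℕ} {w : List B} {r s u : List A} (hr : r.length ≤ M) (hu : (C + 1) * M < u.length)
    (h : s ++ u = w.flatMap g ++ r) :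
    ∃ w' v, w = w' ++ v ∧ C ≤ v.length ∧ v.flatMap g ++ r <:+ u := by
  have hC : C ≤ w.length := by
    by_contra hlt
    have h1 := length_flatMap_le hM w
    have h2 : w.length * M ≤ C * M := Nat.mul_le_mul_right _ (by omega)
    have h3 := congrArg List.length h
    simp only [List.length_append] at h3
    rw [Nat.succ_mul] at hu
    omega
  have hv : (w.drop (w.length - C)).length = C := by rw [List.length_drop]; omega
  refine ⟨w.take (w.length - C), w.drop (w.length - C), (List.take_append_drop _ _).symm,
    hv.ge, ?_⟩
  have h1 := length_flatMap_le hM (w.drop (w.length - C))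
  rw [hv] at h1
  refine List.suffix_of_suffix_length_le (l₃ := s ++ u) ?_ (List.suffix_append _ _) ?_
  · rw [h]
    conv_rhs => rw [← List.take_append_drop (w.length - C) w, List.flatMap_append,
      List.append_assoc]
    exact List.suffix_append _ _
  · rw [Nat.succ_mul] at hu
    rw [List.length_append]
    omega

/-- A long factor that starts inside the image of a letter covers the images of many letters after
it. -/
theorem exists_prefix_images {A B : Type*} {g : B → List A} {M : ℕ} (hM : ∀ b, (g b).length ≤ M)
    {C : ℕ} {w : List B} {r t u : List A} (hr : r.length ≤ M) (hu : (C + 1) * M < u.length)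
    (h : u ++ t = r ++ w.flatMap g) :
    ∃ v w', w = v ++ w' ∧ C ≤ v.length ∧ r ++ v.flatMap g <+: u := by
  have hC : C ≤ w.length := by
    by_contra hlt
    have h1 := length_flatMap_le hM w
    have h2 : w.length * M ≤ C * M := Nat.mul_le_mul_right _ (by omega)
    have h3 := congrArg List.length h
    simp only [List.length_append] at h3
    rw [Nat.succ_mul] at hu
    omega
  have hv : (w.take C).length = C := by rw [List.length_take]; omega
  refine ⟨w.take C, w.drop C, (List.take_append_drop _ _).symm, hv.ge, ?_⟩
  have h1 := length_flatMap_le hM (w.take C)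
  rw [hv] at h1
  refine List.prefix_of_prefix_length_le (l₃ := u ++ t) ?_ (List.prefix_append _ _) ?_
  · rw [h]
    conv_rhs => rw [← List.take_append_drop C w, List.flatMap_append, ← List.append_assoc]
    exact List.prefix_append _ _
  · rw [Nat.succ_mul] at hu
    rw [List.length_append]
    omega

namespace DF0LSystem

open FreeMonoid

variable {A : Type*} {S : DF0LSystem A}

theorem IsBoundedWord.one : S.IsBoundedWord 1 :=
  ⟨0, fun k => by rw [iterate_map_one]; exact le_rfl⟩

theorem IsBoundedWord.mul {u v : FreeMonoid A} (hu : S.IsBoundedWord u) (hv : S.IsBoundedWord v) :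
    S.IsBoundedWord (u * v) := by
  obtain ⟨C, hC⟩ := hu
  obtain ⟨D, hD⟩ := hv
  refine ⟨C + D, fun k => ?_⟩
  rw [iterate_map_mul, length_mul]
  exact add_le_add (hC k) (hD k)

theorem IsBoundedWord.pow {u : FreeMonoid A} (hu : S.IsBoundedWord u) (k : ℕ) :
    S.IsBoundedWord (u ^ k) := by
  induction k with
  | zero => exact .one
  | succ k ih => rw [pow_succ]; exact ih.mul hu

theorem IsBoundedWord.of_infix {u v : FreeMonoid A} (hv : S.IsBoundedWord v)
    (h : toList u <:+: toList v) : S.IsBoundedWord u := by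
  obtain ⟨x, y, e⟩ := h
  have e' : v = ofList x * u * ofList y := e.symm
  obtain ⟨C, hC⟩ := hv
  refine ⟨C, fun k => le_trans ?_ (hC k)⟩
  rw [e', iterate_map_mul, iterate_map_mul, length_mul, length_mul]
  omega

theorem IsBoundedWord.of_iterate (hS : S.IsPDF0L) {n : ℕ} {u : FreeMonoid A}
    (h : S.IsBoundedWord (S.φ^[n] u)) : S.IsBoundedWord u := by
  obtain ⟨C, hC⟩ := h
  refine ⟨C, fun k => le_trans ?_ (hC k)⟩
  rw [← Function.iterate_add_apply, Nat.add_comm, Function.iterate_add_apply]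
  exact length_le_length_iterate hS n _

theorem length_img_succ (hS : S.IsPDF0L) (n : ℕ) (a : A) :
    (S.img n a).length ≤ (S.img (n + 1) a).length := by
  rw [img_succ]
  exact length_le_length_flatMap (img_ne_nil hS 1) _

/-- The images of the bounded letters have stationary lengths from some common index on. -/
theorem exists_stationary [Finite A] (hS : S.IsPDF0L) : ∃ J, ∀ a, S.IsBoundedWord (of a) →
    (S.img (J + 1) a).length = (S.img J a).length := by
  have hmono : ∀ a, Monotone fun n => (S.img n a).length := fun a =>
    monotone_nat_of_le_succ fun n => length_img_succ hS n a
  have h : ∀ a, ∃ J, S.IsBoundedWord (of a) →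
      ∀ n, (S.img n a).length ≤ (S.img J a).length := by
    intro a
    by_cases ha : S.IsBoundedWord (of a)
    · obtain ⟨C, hC⟩ := ha
      have hbdd : BddAbove (Set.range fun n => (S.img n a).length) :=
        ⟨C, by rintro _ ⟨n, rfl⟩; exact hC n⟩
      obtain ⟨J, hJ⟩ := Nat.sSup_mem (Set.range_nonempty _) hbdd
      refine ⟨J, fun _ n => ?_⟩
      have := le_csSup hbdd ⟨n, rfl⟩
      rw [← hJ] at this
      exact this
    · exact ⟨0, fun h => absurd h ha⟩
  choose J hJ using h
  have := Fintype.ofFinite A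
  refine ⟨Finset.univ.sup J, fun a ha => le_antisymm ?_ (length_img_succ hS _ a)⟩
  exact (hJ a ha _).trans (hmono a (Finset.le_sup (Finset.mem_univ a)))

/-- Deep inside a bounded word of the language all letters have images of length one: their
ancestors of a fixed order are bounded letters, as the image of an unbounded letter does not fit
into a bounded word. -/
theorem exists_length_img_eq_one [Finite A] (hS : S.IsPDF0L) : ∃ C, ∀ (x y : List A) (c : A),
    ofList (x ++ c :: y) ∈ S.language → S.IsBoundedWord (ofList (x ++ c :: y)) →
    C ≤ x.length → C ≤ y.length → (S.img 1 c).length = 1 := by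
  have := Fintype.ofFinite A
  obtain ⟨J, hJ⟩ := exists_stationary hS
  obtain ⟨C, hC⟩ := S.exists_ancestor J
  refine ⟨C + ∑ a, (S.img J a).length, fun x y c hL hb hx hy => ?_⟩
  obtain ⟨w, -, x', y', e⟩ := hC _ hL (by
    change C < (x ++ c :: y).length
    rw [List.length_append, List.length_cons]
    omega)
  have e' : (toList w).flatMap (S.img J) = (toList x' ++ x) ++ c :: (y ++ toList y') := by
    rw [← toList_iterate, e]
    simp
  obtain ⟨w₁, d, w₂, r₁, r₂, -, hd, h1, h2⟩ := exists_covering_letter e'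
  have hdlen := length_le_sum (S.img J) d
  have hd' := congrArg List.length hd
  rw [List.length_append, List.length_cons] at hd'
  by_cases hdb : S.IsBoundedWord (of d)
  · have h3 := hJ d hdb
    rw [img_succ, hd, List.flatMap_append, List.flatMap_cons] at h3
    have h4 := length_le_length_flatMap (img_ne_nil hS 1) r₁
    have h5 := length_le_length_flatMap (img_ne_nil hS 1) r₂
    have h6 := List.length_pos_iff.2 (img_ne_nil hS 1 c)
    simp only [List.length_append, List.length_cons] at h3
    omega
  · refine absurd (IsBoundedWord.of_iterate hS (n := J) (hb.of_infix ?_)) hdb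
    change S.img J d <:+: x ++ c :: y
    obtain ⟨x₁, rfl⟩ : r₁ <:+ x := List.suffix_of_suffix_length_le
      (l₃ := toList x' ++ x) (h1 ▸ List.suffix_append _ _) (List.suffix_append _ _) (by omega)
    obtain ⟨y₁, rfl⟩ : r₂ <+: y := List.prefix_of_prefix_length_le
      (l₃ := y ++ toList y') (h2 ▸ List.prefix_append _ _) (List.prefix_append _ _) (by omega)
    exact ⟨x₁, y₁, by rw [hd]; simp⟩

/-- Long bounded words are weakly synchronized. -/
theorem exists_isWeaklySynchronized_of_isBoundedWord [Finite A] (hS : S.IsPDF0L) : ∃ D, ∀ u,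
    S.IsBoundedWord u → D < u.length → S.IsWeaklySynchronized u := by
  have := Fintype.ofFinite A
  obtain ⟨C, hC⟩ := exists_length_img_eq_one hS
  obtain ⟨M, hM⟩ : ∃ M, M = ∑ a, (S.img 1 a).length := ⟨_, rfl⟩
  have hgM : ∀ a, (S.img 1 a).length ≤ M := fun a => hM ▸ length_le_sum (S.img 1) a
  obtain ⟨E, hE⟩ : ∃ E, E = (C + 1) * M + 1 := ⟨_, rfl⟩
  -- The cut is at position `E`, which is far from both ends of `u`.
  refine ⟨2 * E + 1, fun u hb hu => ?_⟩
  change _ < (toList u).length at hu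
  obtain ⟨c, u₂, hcu⟩ : ∃ c u₂, (toList u).drop E = c :: u₂ :=
    List.exists_cons_of_ne_nil (List.length_pos_iff.1 (by rw [List.length_drop]; omega))
  have hsplit : toList u = (toList u).take E ++ c :: u₂ := by
    rw [← hcu, List.take_append_drop]
  have hu₁ : ((toList u).take E).length = E := by rw [List.length_take]; omega
  have hu₂ : E ≤ u₂.length := by
    have := congrArg List.length hcu
    rw [List.length_drop, List.length_cons] at this
    omega
  obtain ⟨u₁, hu₁'⟩ : ∃ u₁, u₁ = (toList u).take E := ⟨_, rfl⟩
  rw [← hu₁'] at hsplit hu₁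
  refine isWeaklySynchronized_of_split hsplit fun s w t hw e => ?_
  rw [← List.append_assoc, List.append_assoc _ _ t, List.cons_append] at e
  obtain ⟨w₁, d, w₂, r₁, r₂, rfl, hd, h1, h2⟩ := exists_covering_letter e
  have hd' := congrArg List.length hd
  rw [List.length_append, List.length_cons] at hd'
  have hdM := hgM d
  obtain ⟨w₁', v₁, rfl, hv₁, s1, hs1⟩ :=
    exists_suffix_images hgM (C := C) (by omega) (by omega) h1
  obtain ⟨v₂, w₂', rfl, hv₂, p1, hp1⟩ :=
    exists_prefix_images hgM (C := C) (by omega) (by omega) h2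
  have hone : (S.img 1 d).length = 1 := by
    refine hC v₁ v₂ d (mem_language_of_infix ?_ hw) ?_ hv₁ hv₂
    · exact ⟨w₁', w₂', by simp⟩
    · refine IsBoundedWord.of_iterate hS (n := 1) (hb.of_infix ?_)
      rw [toList_iterate, hsplit, ← hs1, ← hp1]
      exact ⟨s1, p1, by simp [hd]⟩
  have hr₁ : r₁ = [] := List.length_eq_zero_iff.1 (by omega)
  have hr₂ : r₂ = [] := List.length_eq_zero_iff.1 (by omega)
  subst hr₁ hr₂
  refine ⟨w₁' ++ v₁, d :: (v₂ ++ w₂'), rfl, by rw [h1, List.append_nil], ?_⟩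
  rw [List.flatMap_cons, hd, List.cons_append, h2]
  simp

/-- If the words of bounded length with a property have arbitrarily high powers in the language,
then one of them has all its powers there. -/
theorem exists_forall_pow_mem [Finite A] {Q : FreeMonoid A → Prop} {P : ℕ}
    (h : ∀ k : ℕ, ∃ z : FreeMonoid A, z.length ≤ P ∧ Q z ∧ z ^ k ∈ S.language) :
    ∃ z : FreeMonoid A, Q z ∧ ∀ k : ℕ, z ^ k ∈ S.language := by
  by_contra! hcon
  have : ∀ z : FreeMonoid A, ∃ k, Q z → z ^ k ∉ S.language := by
    intro z
    by_cases hz : Q z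
    · obtain ⟨k, hk⟩ := hcon z hz
      exact ⟨k, fun _ => hk⟩
    · exact ⟨0, fun h => absurd h hz⟩
  choose K hK using this
  have hfin : {z : FreeMonoid A | z.length ≤ P}.Finite := List.finite_length_le A P
  obtain ⟨z, hzP, hQ, hz⟩ := h (hfin.toFinset.sup K)
  have hle : K z ≤ hfin.toFinset.sup K := Finset.le_sup (by simpa using hzP)
  refine hK z hQ (mem_language_of_mul (x := 1) (y := z ^ (hfin.toFinset.sup K - K z)) ?_)
  rwa [one_mul, ← pow_add, Nat.add_sub_cancel' hle]

/-- A long word that is not weakly synchronized contains a high power of a short word, which cannot be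
bounded, as otherwise that power would be weakly synchronized. -/
theorem isUnboundedlyRepetitive_of_not_isWeaklyCircular [Finite A] (hS : S.IsPDF0L)
    (h : ¬ S.IsWeaklyCircular) : S.IsUnboundedlyRepetitive := by
  have hD : ∀ D : ℕ, ∃ u ∈ S.language, D < u.length ∧ ¬ S.IsWeaklySynchronized u := by
    intro D
    by_contra! hcon
    exact h ⟨D, hcon⟩
  obtain ⟨P, hP⟩ := exists_power_or_isWeaklySynchronized hS
  obtain ⟨C, hC⟩ := exists_isWeaklySynchronized_of_isBoundedWord hS
  obtain ⟨z, hz, hzk⟩ := exists_forall_pow_mem (S := S) (Q := fun z => ¬ S.IsBoundedWord z)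
    (P := P) (by
      intro k
      obtain ⟨D, hD'⟩ := hP (k + (C + 1))
      obtain ⟨u, hu, hDu, hws⟩ := hD D
      obtain ⟨z, hz0, hzP, hzu⟩ := (hD' u hu hDu).resolve_right hws
      rw [← toList_ofList z, ← toList_pow] at hzu
      refine ⟨ofList z, hzP, fun hb => hws ?_, ?_⟩
      · refine (hC _ (hb.pow _) ?_).of_infix hzu
        have hpos := List.length_pos_iff.2 hz0
        have hlen : ((ofList z) ^ (k + (C + 1))).length = (k + (C + 1)) * z.length := by
          change (toList ((ofList z) ^ (k + (C + 1)))).length = _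
          rw [toList_pow]
          simp
        rw [hlen]
        nlinarith
      · refine mem_language_of_mul (x := 1) (y := ofList z ^ (C + 1)) ?_
        rw [one_mul, ← pow_add]
        exact mem_language_of_infix hzu hu)
  exact ⟨z, by simpa using hzk 1, hz, hzk⟩

end DF0LSystem

/-! ### Strong circularity and repetitions -/

/-- A prefix of a power of `z` is a power of `z` followed by a prefix of `z`. -/
theorem exists_eq_of_prefix_replicate {A : Type*} {z : List A} {K : ℕ} : ∀ {v : List A},
    v <+: (List.replicate K z).flatten →
    ∃ a p q, a ≤ K ∧ z = p ++ q ∧ v = (List.replicate a z).flatten ++ p := by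
  induction K with
  | zero =>
    intro v h
    exact ⟨0, [], z, le_rfl, rfl, by simpa using h⟩
  | succ K ih =>
    intro v h
    rw [List.replicate_succ, List.flatten_cons] at h
    rcases le_total v.length z.length with hl | hl
    · obtain ⟨q, hq⟩ := List.prefix_of_prefix_length_le h (List.prefix_append _ _) hl
      exact ⟨0, v, q, Nat.zero_le _, hq.symm, by simp⟩
    · obtain ⟨v', rfl⟩ := List.prefix_of_prefix_length_le (List.prefix_append _ _) h hl
      obtain ⟨a, p, q, ha, hz, rfl⟩ := ih ((List.prefix_append_right_inj _).1 h)
      exact ⟨a + 1, p, q, by omega, hz, by simp [List.replicate_succ]⟩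

theorem flatten_replicate_add {A : Type*} (a b : ℕ) (z : List A) :
    (List.replicate (a + b) z).flatten =
      (List.replicate a z).flatten ++ (List.replicate b z).flatten := by
  rw [List.replicate_add, List.flatten_append]

theorem length_flatten_replicate {A : Type*} (a : ℕ) (z : List A) :
    (List.replicate a z).flatten.length = a * z.length := by
  simp

theorem le_length_flatten_replicate {A : Type*} (a : ℕ) {z : List A} (hz : z ≠ []) :
    a ≤ (List.replicate a z).flatten.length := by
  rw [length_flatten_replicate]
  exact Nat.le_mul_of_pos_right a (List.length_pos_iff.2 hz)

theorem suffix_append_replicate {A : Type*} {r y : List A} (h : r <:+ r ++ y) (K : ℕ) :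
    r <:+ r ++ (List.replicate K y).flatten := by
  induction K with
  | zero => simp
  | succ K ih =>
    rw [flatten_replicate_add, ← List.append_assoc]
    refine h.trans ?_
    have : (List.replicate 1 y).flatten = y := by simp
    rw [this]
    obtain ⟨e, he⟩ := ih
    exact ⟨e, by rw [← List.append_assoc, he]⟩

/-- A word `r` of period `y` whose image is as long as the image of `y ^ m` ends with `y ^ m`. -/
theorem replicate_suffix_of_period {A B : Type*} {g : B → List A} (h0 : ∀ b, g b ≠ [])
    {r y : List B} {m : ℕ} (hy : y ≠ []) (h : r <:+ r ++ y)
    (hm : ((List.replicate m y).flatten.flatMap g).length ≤ (r.flatMap g).length) :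
    (List.replicate m y).flatten <:+ r := by
  have h1 : r <:+ (List.replicate (r.length + m) y).flatten := by
    refine List.suffix_of_suffix_length_le (suffix_append_replicate h _) (List.suffix_append _ _) ?_
    have := le_length_flatten_replicate (r.length + m) hy
    omega
  have h2 : (List.replicate m y).flatten <:+ (List.replicate (r.length + m) y).flatten := by
    rw [flatten_replicate_add]
    exact List.suffix_append _ _
  rcases List.suffix_or_suffix_of_suffix h2 h1 with h3 | ⟨e, he⟩
  · exact h3
  · have h4 := length_le_length_flatMap h0 e
    rw [← he, List.flatMap_append, List.length_append] at hm
    have : e = [] := List.length_eq_zero_iff.1 (by omega)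
    rw [← he, this]
    exact List.suffix_rfl

namespace DF0LSystem

open FreeMonoid

variable {A : Type*} {S : DF0LSystem A}

theorem isInterpretation_of_list {u s w t : List A} (hw : ofList w ∈ S.language)
    (h : w.flatMap (S.img 1) = s ++ u ++ t) :
    S.IsInterpretation (ofList u) (ofList s) (ofList w) (ofList t) := by
  refine ⟨?_, hw⟩
  apply toList.injective
  rw [toList_φ]
  exact h

/-- Every occurrence of a strongly synchronizing pair in an image gives a cut behind one and the
same letter. -/
theorem IsStronglySynchronizing.exists_letter {u₁ u₂ : List A}
    (h : S.IsStronglySynchronizing (ofList u₁) (ofList u₂)) :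
    ∃ a : A, ∀ s w t : List A, ofList w ∈ S.language →
      w.flatMap (S.img 1) = s ++ u₁ ++ (u₂ ++ t) →
      ∃ x w₂, w = x ++ [a] ++ w₂ ∧ (x ++ [a]).flatMap (S.img 1) = s ++ u₁ ∧
        w₂.flatMap (S.img 1) = u₂ ++ t := by
  obtain ⟨-, a, ha⟩ := h
  refine ⟨a, fun s w t hw e => ?_⟩
  obtain ⟨w₁, w₂, ⟨h1, h2, h3⟩, x, rfl⟩ := ha (ofList s) (ofList w) (ofList t)
    (isInterpretation_of_list hw (u := u₁ ++ u₂) (by rw [e]; simp only [List.append_assoc]))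
  refine ⟨toList x, toList w₂, h1.symm, ?_, ?_⟩
  · have h4 := congrArg toList h2
    rw [toList_φ] at h4
    exact h4
  · rw [← toList_φ]; exact congrArg toList h3

/-- A pair of long words with one common cut in an image is strongly synchronizing. -/
theorem isStronglySynchronizing_of_split {D : ℕ}
    (hD : ∀ u' u'' : FreeMonoid A, S.IsAdmissible u' u'' → D < u'.length → D < u''.length →
      S.IsStronglySynchronizing u' u'')
    {u₁ u₂ s t w₁ w₂ : List A} (hw : ofList (w₁ ++ w₂) ∈ S.language)
    (h1 : w₁.flatMap (S.img 1) = s ++ u₁) (h2 : w₂.flatMap (S.img 1) = u₂ ++ t)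
    (hl1 : D < u₁.length) (hl2 : D < u₂.length) :
    S.IsStronglySynchronizing (ofList u₁) (ofList u₂) := by
  refine hD _ _ ⟨ofList s, ofList (w₁ ++ w₂), ofList t,
    isInterpretation_of_list hw (u := u₁ ++ u₂) ?_, ofList w₁, ofList w₂, rfl, ?_, ?_⟩ hl1 hl2
  · rw [List.flatMap_append, h1, h2]; simp only [List.append_assoc]
  · apply toList.injective; rw [toList_φ]; exact h1
  · apply toList.injective; rw [toList_φ]; exact h2

/-- In a strongly circular system, two cuts with the same surroundings are preceded by the same
word of preimages. -/
theorem exists_common_suffix (hS : S.IsPDF0L) {D : ℕ}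
    (hD : ∀ u' u'' : FreeMonoid A, S.IsAdmissible u' u'' → D < u'.length → D < u''.length →
      S.IsStronglySynchronizing u' u'')
    {u v s₁ s₂ t₁ t₂ x₁ x₂ y₁ y₂ : List A} (hL₁ : ofList (x₁ ++ y₁) ∈ S.language)
    (hL₂ : ofList (x₂ ++ y₂) ∈ S.language) (hx₁ : x₁.flatMap (S.img 1) = s₁ ++ u)
    (hx₂ : x₂.flatMap (S.img 1) = s₂ ++ u) (hy₁ : y₁.flatMap (S.img 1) = v ++ t₁)
    (hy₂ : y₂.flatMap (S.img 1) = v ++ t₂) (hv : D < v.length) (n : ℕ) (hn : D + n ≤ u.length) :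
    ∃ r, r <:+ x₁ ∧ r <:+ x₂ ∧ n ≤ (r.flatMap (S.img 1)).length := by
  have hg0 : ∀ a, S.img 1 a ≠ [] := img_ne_nil hS 1
  induction n with
  | zero => exact ⟨[], List.nil_suffix, List.nil_suffix, Nat.zero_le _⟩
  | succ n ih =>
    obtain ⟨r, h1, h2, hr⟩ := ih (by omega)
    rcases Nat.lt_or_ge n (r.flatMap (S.img 1)).length with hlt | hge
    · exact ⟨r, h1, h2, hlt⟩
    obtain ⟨x₁, rfl⟩ := h1
    obtain ⟨x₂, rfl⟩ := h2
    obtain ⟨u, rfl⟩ : r.flatMap (S.img 1) <:+ u := by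
      refine List.suffix_of_suffix_length_le (l₃ := s₁ ++ u) ?_ (List.suffix_append _ _) (by omega)
      rw [← hx₁, List.flatMap_append]
      exact List.suffix_append _ _
    rw [List.length_append] at hn
    rw [List.flatMap_append, ← List.append_assoc, List.append_cancel_right_eq] at hx₁ hx₂
    rw [List.append_assoc] at hL₁ hL₂
    have hry : ∀ {y t}, y.flatMap (S.img 1) = v ++ t →
        (r ++ y).flatMap (S.img 1) = r.flatMap (S.img 1) ++ v ++ t := by
      intro y t h
      rw [List.flatMap_append, h, List.append_assoc]
    obtain ⟨c, hc⟩ := (isStronglySynchronizing_of_split hD hL₁ hx₁ (hry hy₁) (by omega)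
      (by rw [List.length_append]; omega)).exists_letter
    -- The cut provided by `c` is the one in front of `r`.
    have key : ∀ {x s y t}, ofList (x ++ (r ++ y)) ∈ S.language → x.flatMap (S.img 1) = s ++ u →
        y.flatMap (S.img 1) = v ++ t → c :: r <:+ x ++ r := by
      intro x s y t hL hx hy
      obtain ⟨x', w₂, e, e1, -⟩ := hc s _ t hL (by rw [List.flatMap_append, hx, hry hy])
      have hxx : x' ++ [c] = x := by
        have p1 : x' ++ [c] <+: x ++ (r ++ y) := e ▸ List.prefix_append _ _
        have p2 : x <+: x ++ (r ++ y) := List.prefix_append _ _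
        have hle : (x' ++ [c]).flatMap (S.img 1) = x.flatMap (S.img 1) := by rw [e1, hx]
        have q1 := prefix_of_length_flatMap_le hg0 p1 p2 (by rw [hle])
        have q2 := prefix_of_length_flatMap_le hg0 p2 p1 (by rw [hle])
        exact q1.eq_of_length (le_antisymm q1.length_le q2.length_le)
      exact ⟨x', by rw [← hxx]; simp⟩
    refine ⟨c :: r, key hL₁ hx₁ hy₁, key hL₂ hx₂ hy₂, ?_⟩
    have := List.length_pos_iff.2 (hg0 c)
    rw [List.flatMap_cons, List.length_append]
    omega

theorem length_pow (z : FreeMonoid A) (m : ℕ) : (z ^ m).length = m * z.length := by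
  change (toList (z ^ m)).length = _
  rw [toList_pow, length_flatten_replicate]; rfl

/-- The image of a letter cannot cover a high power of `z`, so a long enough power of `z` in an
image has a cut. -/
theorem exists_cut_in_power [Finite A] (S : DF0LSystem A) :
    ∃ M, ∀ {z s t w : FreeMonoid A} {j K : ℕ}, z ≠ 1 → M ≤ K →
      S.φ w = s * z ^ j * (z ^ K * t) → ∃ a p q w₁ w₂, a ≤ M ∧ z = p * q ∧ w = w₁ * w₂ ∧
        S.φ w₁ = s * (z ^ (j + a) * p) := by
  have := Fintype.ofFinite A
  refine ⟨∑ a, (S.img 1 a).length, fun {z s t w j K} hz hK e => ?_⟩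
  obtain ⟨M, hM⟩ : ∃ M, M = ∑ a, (S.img 1 a).length := ⟨_, rfl⟩
  rw [← hM] at hK ⊢
  have hgM : ∀ a, (S.img 1 a).length ≤ M := fun a => hM ▸ length_le_sum (S.img 1) a
  obtain ⟨K, rfl⟩ := Nat.exists_eq_add_of_le hK
  have e' : (toList w).flatMap (S.img 1) =
      toList (s * z ^ j) ++ (toList (z ^ M) ++ toList (z ^ K * t)) := by
    rw [← toList_φ, e, pow_add, mul_assoc (z ^ M)]; rfl
  obtain ⟨v, w₁, w₂, hw₁₂, hv, hvM⟩ := exists_overhang (v₀ := []) (Y := toList w)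
    (m := toList (s * z ^ j)) hgM (Nat.zero_le _)
    (by rw [List.nil_append, e']; exact List.prefix_append _ _)
  rw [List.nil_append] at hv
  rw [hw₁₂, List.flatMap_append, ← hv, List.append_assoc _ v, List.append_cancel_left_eq] at e'
  have hvpre : v <+: (List.replicate M (toList z)).flatten := by
    refine List.prefix_of_prefix_length_le (List.prefix_append _ _)
      (l₃ := v ++ w₂.flatMap (S.img 1)) ?_ (hvM.trans (le_length_flatten_replicate M hz))
    rw [e', toList_pow]
    exact List.prefix_append _ _
  obtain ⟨a, p, q, haM, hpq, rfl⟩ := exists_eq_of_prefix_replicate hvpre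
  refine ⟨a, ofList p, ofList q, ofList w₁, ofList w₂, haM, hpq, hw₁₂, ?_⟩
  apply toList.injective
  rw [toList_φ, toList_ofList, ← hv, ← toList_pow, pow_add]
  simp only [toList_mul, toList_ofList, List.append_assoc]

/-- In a strongly circular system, a word with all powers in the language is, up to conjugation,
the image of another such word. -/
theorem exists_desubstitution [Finite A] (hS : S.IsPDF0L) (hcirc : S.IsStronglyCircular)
    {z : FreeMonoid A} (hz : z ≠ 1) (hzL : ∀ k : ℕ, z ^ k ∈ S.language) :
    ∃ y : FreeMonoid A, (∃ p q, z = p * q ∧ S.φ y = q * p) ∧ ∀ k : ℕ, y ^ k ∈ S.language := by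
  have hg0 : ∀ a, S.img 1 a ≠ [] := img_ne_nil hS 1
  obtain ⟨D, hD⟩ := hcirc
  obtain ⟨C, hC⟩ := S.exists_ancestor 1
  obtain ⟨M, hM⟩ := S.exists_cut_in_power
  have hzpos : 0 < z.length := List.length_pos_iff.2 hz
  suffices h : ∀ m : ℕ, ∃ y : FreeMonoid A, y.length ≤ z.length ∧
      (∃ p q, z = p * q ∧ S.φ y = q * p) ∧ y ^ m ∈ S.language from exists_forall_pow_mem h
  intro m
  -- A cut in the middle of a high power of `z`, behind `z ^ J * p` where `z = p * q`.
  obtain ⟨w, hw, s, t, e⟩ := hC _ (hzL ((D + 1 + m) + (M + (D + 3 + C)))) (by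
    rw [length_pow]
    exact lt_of_lt_of_le (by omega) (Nat.le_mul_of_pos_right _ hzpos))
  obtain ⟨a, p, q, w₁, w₂, haM, hpq, rfl, hw₁⟩ := hM (j := D + 1 + m)
    (K := M + (D + 3 + C)) (t := t) (s := s) (w := w) hz (by omega)
    (by rw [← mul_assoc, mul_assoc s, ← pow_add]; exact e)
  obtain ⟨N, rfl⟩ := Nat.exists_eq_add_of_le haM
  obtain ⟨J, hJ⟩ : ∃ J, J = D + 1 + m + a := ⟨_, rfl⟩
  rw [← hJ] at hw₁
  have hpq' : ∀ x, p * (q * x) = z * x := fun x => by rw [← mul_assoc, ← hpq]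
  have hcomm : ∀ (n : ℕ) x, z * (z ^ n * x) = z ^ n * (z * x) := fun n x => by
    rw [← mul_assoc, ← mul_assoc, (Commute.self_pow z n).eq]
  obtain ⟨t', ht'⟩ : ∃ t', t' = z ^ (N + C) * t := ⟨_, rfl⟩
  have hw₂ : S.φ w₂ = q * z ^ (D + 1) * (z * t') := by
    have e1 : S.φ (w₁ * w₂) = s * z ^ J * (z ^ (D + 3) * t') := by
      have : S.φ (w₁ * w₂) = _ := e
      rw [this, ht', hJ, show D + 1 + m + (a + N + (D + 3 + C)) =
        (D + 1 + m + a) + ((D + 3) + (N + C)) by omega, pow_add z (D + 1 + m + a),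
        pow_add z (D + 3)]
      simp only [mul_assoc]
    refine mul_left_cancel (a := S.φ w₁) ?_
    rw [← map_mul, e1, hw₁]
    simp only [mul_assoc, hpq', pow_succ', hcomm]
  have hlen₁ : D + m * z.length < (z ^ J * p).length := by
    rw [length_mul, length_pow, hJ]
    nlinarith
  have hlen₂ : D < (q * z ^ (D + 1)).length := by
    rw [length_mul, length_pow]
    nlinarith
  have hW₁ : (toList w₁).flatMap (S.img 1) = toList s ++ toList (z ^ J * p) := by
    rw [← toList_φ, hw₁]; rfl
  have hW₂ : (toList w₂).flatMap (S.img 1) = toList (q * z ^ (D + 1)) ++ toList (z * t') := by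
    rw [← toList_φ, hw₂]; rfl
  obtain ⟨c, hc⟩ := (isStronglySynchronizing_of_split hD (w₁ := toList w₁) (w₂ := toList w₂)
    hw hW₁ hW₂ (lt_of_le_of_lt (Nat.le_add_right _ _) hlen₁) hlen₂).exists_letter
  -- The same pair occurs one period later.
  obtain ⟨x, w₂', he, hx, hw₂'⟩ := hc (toList (s * z)) _ (toList t') hw (by
    change (toList (w₁ * w₂)).flatMap (S.img 1) =
      toList (s * z * (z ^ J * p) * ((q * z ^ (D + 1)) * t'))
    rw [← toList_φ, map_mul, hw₁, hw₂]
    simp only [mul_assoc, hpq', hcomm])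
  have hpre : toList w₁ <+: x ++ [c] := by
    refine prefix_of_length_flatMap_le hg0 (List.prefix_append _ (toList w₂))
      (he ▸ List.prefix_append _ _) ?_
    rw [hW₁, hx]
    simp only [toList_mul, List.length_append]
    omega
  obtain ⟨y, hy⟩ := hpre
  have hφy : S.φ (ofList y) = q * p := by
    have h1 : S.φ (w₁ * ofList y) = s * z * (z ^ J * p) := by
      apply toList.injective
      rw [toList_φ, toList_mul, toList_ofList, hy, hx]; rfl
    refine mul_left_cancel (a := S.φ w₁) ?_
    rw [← map_mul, h1, hw₁]
    simp only [mul_assoc, hpq', hcomm]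
  have hylen : (S.φ (ofList y)).length = z.length := by
    rw [hφy, hpq, length_mul, length_mul, Nat.add_comm]
  have hy0 : y ≠ [] := by
    rintro rfl
    rw [ofList_nil, map_one] at hylen
    exact hzpos.ne hylen
  refine ⟨ofList y, ?_, ⟨p, q, hpq, hφy⟩, ?_⟩
  · rw [← hylen]
    exact length_le_length_iterate hS 1 _
  obtain ⟨r, hr₁, hr₂, hr⟩ := exists_common_suffix hS hD (x₁ := toList w₁) (y₁ := toList w₂)
    (x₂ := x ++ [c]) (y₂ := w₂') hw (he ▸ hw) hW₁ hx hW₂ hw₂' hlen₂ (m * z.length) hlen₁.le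
  have hper : r <:+ r ++ y := by
    refine List.suffix_of_suffix_length_le hr₂ ?_ (by simp)
    rw [← hy]
    obtain ⟨d, hd⟩ := hr₁
    exact ⟨d, by rw [← List.append_assoc, hd]⟩
  have hpow := replicate_suffix_of_period hg0 (m := m) hy0 hper (by
    refine le_of_eq_of_le ?_ hr
    rw [← toList_ofList y, ← toList_pow, ← toList_φ, map_pow]
    change (S.φ (ofList y) ^ m).length = _
    rw [length_pow, hylen])
  refine mem_language_of_infix (v := w₁ * w₂) ?_ hw
  rw [toList_pow, toList_ofList]
  exact (hpow.trans hr₁).isInfix.trans (List.prefix_append _ _).isInfix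

/-- Desubstituting a shortest repeated unbounded word again and again yields words of the same length
with iterated images of that length, which is impossible as there are only finitely many of them. -/
theorem not_isStronglyCircular_of_isUnboundedlyRepetitive [Finite A] (hS : S.IsPDF0L)
    (h : S.IsUnboundedlyRepetitive) : ¬ S.IsStronglyCircular := by
  classical
  intro hcirc
  have hex : ∃ l, ∃ z : FreeMonoid A, z.length = l ∧ ¬ S.IsBoundedWord z ∧
      ∀ k : ℕ, z ^ k ∈ S.language := by
    obtain ⟨v, -, hv, hvk⟩ := h
    exact ⟨_, v, rfl, hv, hvk⟩
  obtain ⟨l, hl⟩ : ∃ l, l = Nat.find hex := ⟨_, rfl⟩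
  have hmin : ∀ z : FreeMonoid A, ¬ S.IsBoundedWord z → (∀ k : ℕ, z ^ k ∈ S.language) →
      l ≤ z.length := fun z hz hzk => hl ▸ Nat.find_min' hex ⟨z, rfl, hz, hzk⟩
  have hdesub : ∀ j : ℕ, ∃ z : FreeMonoid A, z.length = l ∧ ¬ S.IsBoundedWord z ∧
      (∀ k : ℕ, z ^ k ∈ S.language) ∧ (S.φ^[j] z).length = l := by
    intro j
    induction j with
    | zero =>
      obtain ⟨z, h1, h2, h3⟩ := Nat.find_spec hex
      exact ⟨z, h1.trans hl.symm, h2, h3, h1.trans hl.symm⟩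
    | succ j ih =>
      obtain ⟨z, hzl, hzb, hzk, hzj⟩ := ih
      have hz1 : z ≠ 1 := by rintro rfl; exact hzb .one
      obtain ⟨y, ⟨p, q, hpq, hy⟩, hyk⟩ := exists_desubstitution hS hcirc hz1 hzk
      have hlen : ∀ n, (S.φ^[n + 1] y).length = (S.φ^[n] z).length := by
        intro n
        rw [Function.iterate_succ_apply, hy, hpq, iterate_map_mul, iterate_map_mul, length_mul,
          length_mul, Nat.add_comm]
      have hyb : ¬ S.IsBoundedWord y := by
        rintro ⟨C, hC⟩
        exact hzb ⟨C, fun k => hlen k ▸ hC (k + 1)⟩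
      refine ⟨y, le_antisymm ?_ (hmin y hyb hyk), hyb, hyk, (hlen j).trans hzj⟩
      rw [← hzl]
      exact (length_le_length_iterate hS 1 y).trans_eq (hlen 0)
  have hgrow : ∀ z : FreeMonoid A, ∃ n, ¬ S.IsBoundedWord z → l < (S.φ^[n] z).length := by
    intro z
    by_cases hz : S.IsBoundedWord z
    · exact ⟨0, fun h => absurd hz h⟩
    · by_contra! hcon
      exact hz ⟨l, fun k => (hcon k).2⟩
  choose n hn using hgrow
  have hfin : {z : FreeMonoid A | z.length ≤ l}.Finite := List.finite_length_le A l
  obtain ⟨z, hzl, hzb, -, hzj⟩ := hdesub (hfin.toFinset.sup n)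
  have hle : n z ≤ hfin.toFinset.sup n := Finset.le_sup (by simpa using hzl.le)
  obtain ⟨d, hd⟩ := Nat.exists_eq_add_of_le hle
  have h1 := length_le_length_iterate hS d (S.φ^[n z] z)
  rw [← Function.iterate_add_apply, Nat.add_comm d, ← hd, hzj] at h1
  exact absurd (hn z hzb) (by omega)

end DF0LSystem

theorem theoremt {A : Type*} [Finite A] (S : DF0LSystem A) (hS : S.IsPDF0L) :
    (¬ S.IsWeaklyCircular → S.IsUnboundedlyRepetitive) ∧
      (S.IsUnboundedlyRepetitive → ¬ S.IsStronglyCircular) :=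
  ⟨DF0LSystem.isUnboundedlyRepetitive_of_not_isWeaklyCircular hS,
    DF0LSystem.not_isStronglyCircular_of_isUnboundedlyRepetitive hS⟩
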